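/- **Setting.** Let $\mathbb K$ be $\mathbb R$ or $\mathbb C$ (the coefficients of the forms). Let $X$ be a (reduced, abstract) complex analytic variety: a second countable Hausdorff space with an open covering $\{A_l\}_{l}$ and homeomorphisms $F_l$ of $A_l$ onto an analytic subset $F_l(A_l)$ of an open set $U_l\subseteq\mathbb C^{n_l}$ (locally in $U_l$ the common zero set of finitely many holomorphic functions), such that every transition map $F_l\circ F_k^{-1}$ is, locally, the restriction of a holomorphic map between open subsets of $\mathbb C^{n_k}$ and $\mathbb C^{n_l}$. Let $X'\subseteq X$ be the open set of regular points, i.e. the points near which $X$ is a complex manifold. Let $Z\subseteq X$ be either empty or the closure of a non-empty open subset of $X$ (for example, such a closure which is moreover a polyhedron of $X$). **Extendable forms.** For $S\subseteq X$ an *extendable $p$-form over $S$* is a section $\theta$ over $S\cap X'$ of the bundle of ($\mathbb K$-valued, real alternating) $p$-covectors of the manifold $X'$ such that every $x\in S$, singular or not, has a chart $F_l$ with $x\in A_l$, an open set $O\subseteq U_l$ with $F_l(x)\in O$, and a smooth $p$-form $\eta$ on $O$ with $\theta=F_l^*\eta$ at all points of $S\cap X'\cap A_l\cap F_l^{-1}(O)$.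 If $S$ is open, or the intersection of $Z$ with an open set, the exterior differential $d\theta$ is the extendable $(p+1)$-form given near each point by $F_l^*(d\eta)$; for $S$ open it is the usual differential on $X'$. For $V\subseteq X$ open, let $\Gamma^p(V)$ be the space of extendable $p$-forms over $V$ and $\Gamma^p(V)_Z\subseteq\Gamma^p(V)$ the subspace of the forms that vanish at every point of $V\cap Z\cap X'$; let $\Gamma^p(Z)$ be the space of extendable $p$-forms over $Z$, with $\Gamma^{-1}(Z)=0$. **Cohomologies.** - $H^r_{ext}(X)_Z$ is the $r$-th cohomology of the complex $(\Gamma^\bullet(X)_Z,d)$. - $H^r_{ext}(X,Z)$ is the $r$-th cohomology of the complex $\Gamma^p(X)\oplus\Gamma^{p-1}(Z)$ with differential $(\kappa,\upsilon)\mapsto(d\kappa,\ \kappa|_Z-d\upsilon)$. The map $\omega\mapsto(\omega,0)$ induces $A^r:H^r_{ext}(X)_Z\to H^r_{ext}(X,Z)$. - Let $\mathcal V=\{V_j\}_{j\in J}$ be an open covering of $X$ *adapted to $Z$*: $Z=\emptyset$, or $Z$ is contained in one member $V_{j(Z)}=V_Z$ and disjoint from $V_j$ for every $j\ne j(Z)$.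 Put $$C^p_q=\prod_{(j_0,\dots,j_q)\in J^{q+1}}\Gamma^p(V_{j_0}\cap\dots\cap V_{j_q})_Z,\qquad K^r=\bigoplus_{p+q=r}C^p_q ,$$ $$(\delta\omega)_{j_0\dots j_{q+1}}=\sum_{m=0}^{q+1}(-1)^m\,\omega_{j_0\dots\widehat{j_m}\dots j_{q+1}}\big|_{V_{j_0}\cap\dots\cap V_{j_{q+1}}},\qquad D=\delta+(-1)^q d\ \text{ on } C^p_q .$$ $\check H^r_{ext}(X,\mathcal V,V_Z)$ is the $r$-th cohomology of $(K^\bullet,D)$. The restriction map $P^r:\Gamma^r(X)_Z\to C^r_0\subseteq K^r$, $\omega\mapsto(\omega|_{V_j})_{j\in J}$, is a cochain map. **Theorem.** For every $r\in\mathbb N$ the map $A^r:H^r_{ext}(X)_Z\to H^r_{ext}(X,Z)$ is bijective, and $P^r$ induces a $\mathbb K$-linear isomorphism $$P^{r*}:H^r_{ext}(X,Z)\longrightarrow\check H^r_{ext}(X,\mathcal V,V_Z),\qquad P^{r*}(A^r[\omega])=[P^r\omega]\quad\text{for all }[\omega]\in H^r_{ext}(X)_Z .$$ -/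

import Mathlib

open Set Topology
open scoped ContDiff

noncomputable section

namespace ExtendableForms

theorem contDiff_alt_pullback {E F G : Type*} [NormedAddCommGroup E] [NormedSpace ℝ E]
    [NormedAddCommGroup F] [NormedSpace ℝ F] [NormedAddCommGroup G] [NormedSpace ℝ G] {p : ℕ} :
    ContDiff ℝ ∞ (fun x : (F [⋀^Fin p]→L[ℝ] G) × (E →L[ℝ] F) ↦
      x.1.compContinuousLinearMap x.2) := by
  let alt : ContinuousMultilinearMap ℝ (fun _ : Fin p ↦ E) G →ₗ[ℝ] E [⋀^Fin p]→L[ℝ] G :=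
    { toFun := ContinuousMultilinearMap.alternatization
      map_add' := map_add _
      map_smul' := fun c f ↦ by
        ext v
        simp [ContinuousMultilinearMap.alternatization_apply_apply, Finset.smul_sum,
          smul_comm c] }
  let altL := alt.mkContinuous (p.factorial : ℝ) (fun f ↦ by
    refine ContinuousAlternatingMap.opNorm_le_bound (f := alt f) (by positivity) fun v ↦ ?_
    change ‖ContinuousMultilinearMap.alternatization f v‖ ≤ _
    rw [ContinuousMultilinearMap.alternatization_apply_apply]
    refine (norm_sum_le _ _).trans ?_
    have : ∀ σ : Equiv.Perm (Fin p), ‖Equiv.Perm.sign σ • f (v ∘ σ)‖ ≤ ‖f‖ * ∏ i, ‖v i‖ := by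
      intro σ
      have h1 : ‖Equiv.Perm.sign σ • f (v ∘ σ)‖ = ‖f (v ∘ σ)‖ := by
        rcases Int.units_eq_one_or (Equiv.Perm.sign σ) with h | h <;> simp [h]
      rw [h1]
      refine (f.le_opNorm _).trans_eq ?_
      congr 1
      exact Equiv.prod_comp σ fun i ↦ ‖v i‖
    refine (Finset.sum_le_sum fun σ _ ↦ this σ).trans_eq ?_
    simp [Finset.card_univ, Fintype.card_perm, mul_assoc])
  have key : ∀ x : (F [⋀^Fin p]→L[ℝ] G) × (E →L[ℝ] F), x.1.compContinuousLinearMap x.2 =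
      ((p.factorial : ℝ)⁻¹ • altL)
        (ContinuousMultilinearMap.compContinuousLinearMapContinuousMultilinear ℝ
          (fun _ : Fin p ↦ E) (fun _ ↦ F) G (fun _ ↦ x.2) x.1.toContinuousMultilinearMap) := by
    intro x
    ext v
    have hm : ∀ m : ContinuousMultilinearMap ℝ (fun _ : Fin p ↦ E) G,
        ((p.factorial : ℝ)⁻¹ • altL) m v =
          (p.factorial : ℝ)⁻¹ • ContinuousMultilinearMap.alternatization m v := fun _ ↦ rfl
    rw [hm, ContinuousMultilinearMap.alternatization_apply_apply]
    have : ∀ σ : Equiv.Perm (Fin p), Equiv.Perm.sign σ •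
        (ContinuousMultilinearMap.compContinuousLinearMapContinuousMultilinear ℝ
          (fun _ : Fin p ↦ E) (fun _ ↦ F) G (fun _ ↦ x.2) x.1.toContinuousMultilinearMap) (v ∘ σ)
        = x.1.compContinuousLinearMap x.2 v := by
      intro σ
      have := (x.1.compContinuousLinearMap x.2).toAlternatingMap.map_perm v σ
      change Equiv.Perm.sign σ • ((x.1.compContinuousLinearMap x.2).toAlternatingMap (v ∘ σ)) = _
      rw [this, smul_smul]
      simp
    rw [Finset.sum_congr rfl fun σ _ ↦ this σ]
    simp [Finset.card_univ, Fintype.card_perm, ← Nat.cast_smul_eq_nsmul ℝ, smul_smul,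
      Nat.factorial_ne_zero]
  simp only [key]
  refine ContinuousLinearMap.contDiff _ |>.comp ?_
  refine ContDiff.clm_apply ?_ ?_
  · exact (ContinuousMultilinearMap.contDiff _).comp (contDiff_pi.2 fun _ ↦ contDiff_snd)
  · exact (ContinuousAlternatingMap.toContinuousMultilinearMapLI (𝕜 := ℝ) (E := F) (F := G) (ι := Fin p)).contDiff.comp contDiff_fst

/-! ### Complex analytic varieties -/

/-- `W` is an analytic subset (holomorphic subvariety) of the open set `U ⊆ ℂⁿ`: around every
point of `U` it is the common zero set of finitely many holomorphic functions. -/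
def IsAnalyticSubset {n : ℕ} (U W : Set (Fin n → ℂ)) : Prop :=
  W ⊆ U ∧ ∀ z ∈ U, ∃ O : Set (Fin n → ℂ), IsOpen O ∧ z ∈ O ∧ O ⊆ U ∧
    ∃ (m : ℕ) (f : Fin m → (Fin n → ℂ) → ℂ), (∀ k, AnalyticOnNhd ℂ (f k) O) ∧
      W ∩ O = {y ∈ O | ∀ k, f k y = 0}

/-- An (abstract, reduced) complex analytic variety: a second countable Hausdorff space `X` with an
atlas `(A l, dim l, U l, W l, F l)`, `l : L`, where the `A l` form an open covering of `X` and
`F l` maps `A l` homeomorphically onto an analytic subset `W l = F l '' A l` of an open set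
`U l ⊆ ℂ^(dim l)`, such that the transition maps are biholomorphisms of analytic sets, i.e. they
are locally restrictions of holomorphic maps between the ambient spaces (the condition for the
pair `(k, l)` concerns the transition map, the one for `(l, k)` its inverse).
The values of `F l` outside `A l` are irrelevant. -/
structure AnalyticVariety (L X : Type*) [TopologicalSpace X] where
  t2Space : T2Space X
  secondCountable : SecondCountableTopology X
  dim : L → ℕ
  A : L → Set X
  U : (l : L) → Set (Fin (dim l) → ℂ)
  F : (l : L) → X → (Fin (dim l) → ℂ)
  isOpen_A : ∀ l, IsOpen (A l)
  iUnion_A : ⋃ l, A l = univ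
  isOpen_U : ∀ l, IsOpen (U l)
  isEmbedding_F : ∀ l, IsEmbedding ((A l).domRestrict (F l))
  isAnalyticSubset : ∀ l, IsAnalyticSubset (U l) (F l '' A l)
  holomorphic_transition : ∀ k l, ∀ x ∈ A k ∩ A l,
    ∃ O : Set (Fin (dim k) → ℂ), IsOpen O ∧ F k x ∈ O ∧
      ∃ G : (Fin (dim k) → ℂ) → (Fin (dim l) → ℂ), AnalyticOnNhd ℂ G O ∧
        ∀ y ∈ A k ∩ A l, F k y ∈ O → G (F k y) = F l y

variable {L X : Type*} [TopologicalSpace X]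

/-- A local holomorphic parametrization of the regular part of `X` (the inverse of a holomorphic
coordinate system on `X`): a biholomorphism `toFun` of an open set `B ⊆ ℂ^dim` onto an open subset
of `X`. The values of `toFun` outside `B` are irrelevant. -/
structure RegularParam (V : AnalyticVariety L X) where
  dim : ℕ
  B : Set (Fin dim → ℂ)
  toFun : (Fin dim → ℂ) → X
  isOpen_B : IsOpen B
  isOpenEmbedding : IsOpenEmbedding (B.domRestrict toFun)
  holomorphic : ∀ l, AnalyticOnNhd ℂ (V.F l ∘ toFun) (B ∩ toFun ⁻¹' V.A l)
  holomorphic_symm : ∀ l, ∀ u ∈ B, toFun u ∈ V.A l →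
    ∃ O : Set (Fin (V.dim l) → ℂ), IsOpen O ∧ V.F l (toFun u) ∈ O ∧
      ∃ G : (Fin (V.dim l) → ℂ) → (Fin dim → ℂ), AnalyticOnNhd ℂ G O ∧
        ∀ v ∈ B, toFun v ∈ V.A l → V.F l (toFun v) ∈ O → G (V.F l (toFun v)) = v

/-- The regular part `X'` of `X`: the points at which `X` is a complex manifold. -/
def AnalyticVariety.regularPart (V : AnalyticVariety L X) : Set X :=
  {x | ∃ (ψ : RegularParam V), ∃ u ∈ ψ.B, ψ.toFun u = x}

variable {V : AnalyticVariety L X}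

namespace RegularParam

/-- The inverse of the parametrization, a coordinate system on `X'`. -/
def symm (ψ : RegularParam V) : X → (Fin ψ.dim → ℂ) :=
  Function.invFunOn ψ.toFun ψ.B

/-- The coordinates of the points of `S ∩ X'` in the range of `ψ`. -/
def dom (ψ : RegularParam V) (S : Set X) : Set (Fin ψ.dim → ℂ) :=
  {u | u ∈ ψ.B ∧ ψ.toFun u ∈ S}

/-- The expression in the coordinates `ψ` of the pull back along the chart `F l` of a form `η` on
the ambient space `ℂ^(dim l)`. -/
def pullback {G : Type*} [NormedAddCommGroup G] [NormedSpace ℝ G]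
    (ψ : RegularParam V) (l : L) {p : ℕ}
    (η : (Fin (V.dim l) → ℂ) → (Fin (V.dim l) → ℂ) [⋀^Fin p]→L[ℝ] G) (u : Fin ψ.dim → ℂ) :
    (Fin ψ.dim → ℂ) [⋀^Fin p]→L[ℝ] G :=
  (η (V.F l (ψ.toFun u))).compContinuousLinearMap (fderiv ℝ (V.F l ∘ ψ.toFun) u)

end RegularParam

/-! ### Extendable differential forms -/

variable (V) in
/-- Families of coordinate expressions, in all local coordinates of `X'`, of `𝕜`-valued real
alternating `p`-forms at the points of `S ∩ X'`. -/
@[ext]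
structure Family (𝕜 : Type*) [RCLike 𝕜] (S : Set X) (p : ℕ) where
  coord : (ψ : RegularParam V) → ψ.dom S → (Fin ψ.dim → ℂ) [⋀^Fin p]→L[ℝ] 𝕜

namespace Family

variable {𝕜 : Type*} [RCLike 𝕜] {S : Set X} {p : ℕ}

instance : Zero (Family V 𝕜 S p) := ⟨⟨0⟩⟩
instance : Add (Family V 𝕜 S p) := ⟨fun θ θ' ↦ ⟨θ.coord + θ'.coord⟩⟩
instance : Neg (Family V 𝕜 S p) := ⟨fun θ ↦ ⟨-θ.coord⟩⟩
instance : Sub (Family V 𝕜 S p) := ⟨fun θ θ' ↦ ⟨θ.coord - θ'.coord⟩⟩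
instance : SMul 𝕜 (Family V 𝕜 S p) := ⟨fun c θ ↦ ⟨fun ψ u ↦ c • θ.coord ψ u⟩⟩
instance : SMul ℕ (Family V 𝕜 S p) := ⟨fun n θ ↦ ⟨n • θ.coord⟩⟩
instance : SMul ℤ (Family V 𝕜 S p) := ⟨fun n θ ↦ ⟨n • θ.coord⟩⟩

theorem coord_injective : Function.Injective (coord : Family V 𝕜 S p → _) :=
  fun _ _ h ↦ Family.ext h

instance : AddCommGroup (Family V 𝕜 S p) :=
  coord_injective.addCommGroup coord rfl (fun _ _ ↦ rfl) (fun _ ↦ rfl) (fun _ _ ↦ rfl)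
    (fun _ _ ↦ rfl) (fun _ _ ↦ rfl)

instance : Module 𝕜 (Family V 𝕜 S p) where
  one_smul θ := Family.ext (funext fun ψ ↦ funext fun u ↦ one_smul 𝕜 (θ.coord ψ u))
  mul_smul a b θ := Family.ext (funext fun ψ ↦ funext fun u ↦ mul_smul a b (θ.coord ψ u))
  smul_zero a := Family.ext (funext fun _ ↦ funext fun _ ↦
    ContinuousAlternatingMap.ext fun _ ↦ smul_zero (A := 𝕜) a)
  smul_add a θ θ' := Family.ext (funext fun ψ ↦ funext fun u ↦
    smul_add a (θ.coord ψ u) (θ'.coord ψ u))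
  add_smul a b θ := Family.ext (funext fun ψ ↦ funext fun u ↦ add_smul a b (θ.coord ψ u))
  zero_smul θ := Family.ext (funext fun ψ ↦ funext fun u ↦ zero_smul 𝕜 (θ.coord ψ u))

theorem add_coord (θ θ' : Family V 𝕜 S p) (ψ : RegularParam V) (u : ψ.dom S) :
    (θ + θ').coord ψ u = θ.coord ψ u + θ'.coord ψ u := rfl

theorem smul_coord (c : 𝕜) (θ : Family V 𝕜 S p) (ψ : RegularParam V) (u : ψ.dom S) :
    (c • θ).coord ψ u = c • θ.coord ψ u := rfl

end Family

section Forms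

variable {𝕜 : Type*} [RCLike 𝕜] {S T : Set X} {p : ℕ}

/-- The coordinate expressions `θ.coord ψ` are those of one and the same section of `Λᵖ T^*X'` over
`S ∩ X'`: they are related by pull back along the changes of coordinates. -/
def IsSection (θ : Family V 𝕜 S p) : Prop :=
  ∀ (ψ φ : RegularParam V) (u : ψ.dom S) (v : φ.dom S), ψ.toFun u = φ.toFun v →
    θ.coord ψ u = (θ.coord φ v).compContinuousLinearMap (fderiv ℝ (φ.symm ∘ ψ.toFun) u)

/-- `η` is a smooth form on the open set `O` of the ambient space `U l` of the chart `F l` whose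
pull back along `F l` is `θ`, at the points of `S ∩ X' ∩ A l` with `F l`-image in `O`. -/
def IsLocalExtension (θ : Family V 𝕜 S p) (l : L) (O : Set (Fin (V.dim l) → ℂ))
    (η : (Fin (V.dim l) → ℂ) → (Fin (V.dim l) → ℂ) [⋀^Fin p]→L[ℝ] 𝕜) : Prop :=
  IsOpen O ∧ O ⊆ V.U l ∧ ContDiffOn ℝ ∞ η O ∧
    ∀ (ψ : RegularParam V) (u : ψ.dom S), ψ.toFun u ∈ V.A l → V.F l (ψ.toFun u) ∈ O →
      θ.coord ψ u = ψ.pullback l η u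

/-- `θ` is extendable: around every point of `S`, singular or not, it is the pull back of a smooth
form on an open subset of the ambient space of some chart. -/
def IsExtendable (θ : Family V 𝕜 S p) : Prop :=
  ∀ x ∈ S, ∃ (l : L) (O : Set (Fin (V.dim l) → ℂ))
    (η : (Fin (V.dim l) → ℂ) → (Fin (V.dim l) → ℂ) [⋀^Fin p]→L[ℝ] 𝕜),
    x ∈ V.A l ∧ V.F l x ∈ O ∧ IsLocalExtension θ l O η

theorem RegularParam.contDiffAt_F (ψ : RegularParam V) {l : L} {u : Fin ψ.dim → ℂ}
    (hu : u ∈ ψ.B) (hl : ψ.toFun u ∈ V.A l) : ContDiffAt ℝ ∞ (V.F l ∘ ψ.toFun) u :=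
  ((ψ.holomorphic l u ⟨hu, hl⟩).restrictScalars (𝕜 := ℝ)).contDiffAt

theorem RegularParam.continuousAt (ψ : RegularParam V) {u : Fin ψ.dim → ℂ}
    (hu : u ∈ ψ.B) : ContinuousAt ψ.toFun u :=
  (continuousOn_iff_continuous_domRestrict.2 ψ.isOpenEmbedding.continuous).continuousAt
    (ψ.isOpen_B.mem_nhds hu)

theorem RegularParam.injOn (ψ : RegularParam V) : InjOn ψ.toFun ψ.B :=
  injOn_iff_injective.2 ψ.isOpenEmbedding.injective

theorem RegularParam.symm_apply (ψ : RegularParam V) {u : Fin ψ.dim → ℂ}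
    (hu : u ∈ ψ.B) : ψ.symm (ψ.toFun u) = u :=
  ψ.injOn.leftInvOn_invFunOn hu

theorem RegularParam.isOpen_image (ψ : RegularParam V) : IsOpen (ψ.toFun '' ψ.B) := by
  have := ψ.isOpenEmbedding.isOpen_range
  rwa [range_domRestrict] at this

/-- Changes of coordinates are smooth and compatible with the charts. -/
theorem RegularParam.change (ψ φ : RegularParam V) {u : Fin ψ.dim → ℂ} {v : Fin φ.dim → ℂ}
    (hu : u ∈ ψ.B) (hv : v ∈ φ.B) (h : ψ.toFun u = φ.toFun v) {l : L} (hl : ψ.toFun u ∈ V.A l) :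
    fderiv ℝ (V.F l ∘ ψ.toFun) u =
      (fderiv ℝ (V.F l ∘ φ.toFun) v).comp (fderiv ℝ (φ.symm ∘ ψ.toFun) u) := by
  obtain ⟨O, hO, hvO, G, hG, hGO⟩ := φ.holomorphic_symm l v hv (h ▸ hl)
  have hF := ψ.contDiffAt_F hu hl
  have e1 : ∀ᶠ u' in 𝓝 u, ψ.toFun u' ∈ φ.toFun '' φ.B :=
    (ψ.continuousAt hu).eventually_mem (φ.isOpen_image.mem_nhds ⟨v, hv, h.symm⟩)
  have e2 : ∀ᶠ u' in 𝓝 u, ψ.toFun u' ∈ V.A l :=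
    (ψ.continuousAt hu).eventually_mem ((V.isOpen_A l).mem_nhds hl)
  have e3 : ∀ᶠ u' in 𝓝 u, V.F l (ψ.toFun u') ∈ O :=
    hF.continuousAt.eventually_mem (hO.mem_nhds (by simpa [h] using hvO))
  have hG' : ContDiffAt ℝ ∞ G (V.F l (ψ.toFun u)) :=
    ((hG _ (by rw [h]; exact hvO)).restrictScalars (𝕜 := ℝ)).contDiffAt
  have heq : φ.symm ∘ ψ.toFun =ᶠ[𝓝 u] G ∘ (V.F l ∘ ψ.toFun) := by
    filter_upwards [e1, e2, e3] with u' ⟨v', hv', hvu⟩ h2 h3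
    simp only [Function.comp_apply]
    rw [← hvu] at h2 h3 ⊢
    rw [φ.symm_apply hv', hGO v' hv' h2 h3]
  have hs : DifferentiableAt ℝ (φ.symm ∘ ψ.toFun) u :=
    ((ContDiffAt.comp u hG' hF).congr_of_eventuallyEq heq).differentiableAt (by simp)
  have heq2 : V.F l ∘ ψ.toFun =ᶠ[𝓝 u] (V.F l ∘ φ.toFun) ∘ (φ.symm ∘ ψ.toFun) := by
    filter_upwards [e1] with u' ⟨v', hv', hvu⟩
    simp only [Function.comp_apply]
    rw [← hvu, φ.symm_apply hv']
  have hv' : (φ.symm ∘ ψ.toFun) u = v := by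
    simp only [Function.comp_apply]; rw [h, φ.symm_apply hv]
  rw [heq2.fderiv_eq, fderiv_comp u _ hs, hv']
  rw [hv']
  exact (φ.contDiffAt_F hv (h ▸ hl)).differentiableAt (by simp)

theorem RegularParam.pullback_change (ψ φ : RegularParam V) {u : Fin ψ.dim → ℂ}
    {v : Fin φ.dim → ℂ} (hu : u ∈ ψ.B) (hv : v ∈ φ.B) (h : ψ.toFun u = φ.toFun v) {l : L}
    (hl : ψ.toFun u ∈ V.A l)
    (η : (Fin (V.dim l) → ℂ) → (Fin (V.dim l) → ℂ) [⋀^Fin p]→L[ℝ] 𝕜) :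
    ψ.pullback l η u =
      (φ.pullback l η v).compContinuousLinearMap (fderiv ℝ (φ.symm ∘ ψ.toFun) u) := by
  unfold RegularParam.pullback
  rw [ψ.change φ hu hv h hl, h]
  rfl

/-- A local extension in one chart yields local extensions in every other chart. -/
theorem IsLocalExtension.transfer {θ : Family V 𝕜 S p} {k : L} {O : Set (Fin (V.dim k) → ℂ)}
    {η : (Fin (V.dim k) → ℂ) → (Fin (V.dim k) → ℂ) [⋀^Fin p]→L[ℝ] 𝕜}
    (h : IsLocalExtension θ k O η) {x : X} (hk : x ∈ V.A k) (hx : V.F k x ∈ O) {l : L}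
    (hl : x ∈ V.A l) :
    ∃ (O' : Set (Fin (V.dim l) → ℂ))
      (η' : (Fin (V.dim l) → ℂ) → (Fin (V.dim l) → ℂ) [⋀^Fin p]→L[ℝ] 𝕜),
      V.F l x ∈ O' ∧ IsLocalExtension θ l O' η' := by
  obtain ⟨Q, hQ, hxQ, G, hG, hGQ⟩ := V.holomorphic_transition l k x ⟨hl, hk⟩
  have hGc : ContDiffOn ℝ ∞ G Q := fun z hz ↦
    ((hG z hz).restrictScalars (𝕜 := ℝ)).contDiffAt.contDiffWithinAt
  obtain ⟨N, hN, hNA⟩ := ((V.isEmbedding_F l).isOpen_iff).1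
    ((V.isOpen_A k).preimage (continuous_subtype_val (p := (· ∈ V.A l))))
  have hNA' : ∀ y ∈ V.A l, V.F l y ∈ N ↔ y ∈ V.A k := fun y hy ↦
    Set.ext_iff.1 hNA ⟨y, hy⟩
  refine ⟨(Q ∩ G ⁻¹' O) ∩ (N ∩ V.U l), fun z ↦ (η (G z)).compContinuousLinearMap (fderiv ℝ G z),
    ⟨⟨hxQ, ?_⟩, (hNA' x hl).2 hk, (V.isAnalyticSubset l).1 ⟨x, hl, rfl⟩⟩, ?_, ?_, ?_, ?_⟩
  · simpa [hGQ x ⟨hl, hk⟩ hxQ] using hx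
  · exact (hGc.continuousOn.isOpen_inter_preimage hQ h.1).inter (hN.inter (V.isOpen_U l))
  · exact fun z hz ↦ hz.2.2
  · refine contDiff_alt_pullback.comp_contDiffOn (s := (Q ∩ G ⁻¹' O) ∩ (N ∩ V.U l))
      (f := fun z ↦ (η (G z), fderiv ℝ G z)) (ContDiffOn.prodMk ?_ ?_)
    · exact h.2.2.1.comp (hGc.mono fun z hz ↦ hz.1.1) fun z hz ↦ hz.1.2
    · exact (hGc.fderiv_of_isOpen hQ (by simp)).mono fun z hz ↦ hz.1.1
  · rintro ψ u hul ⟨⟨huQ, huO⟩, huN, -⟩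
    have huk : ψ.toFun u ∈ V.A k := (hNA' _ hul).1 huN
    have hGF : G (V.F l (ψ.toFun u)) = V.F k (ψ.toFun u) := hGQ _ ⟨hul, huk⟩ huQ
    have hF := ψ.contDiffAt_F u.2.1 hul
    rw [h.2.2.2 ψ u huk (by rw [← hGF]; exact huO)]
    have heq : V.F k ∘ ψ.toFun =ᶠ[𝓝 (u : Fin ψ.dim → ℂ)] G ∘ (V.F l ∘ ψ.toFun) := by
      filter_upwards [(ψ.continuousAt u.2.1).eventually_mem ((V.isOpen_A k).mem_nhds huk),
        (ψ.continuousAt u.2.1).eventually_mem ((V.isOpen_A l).mem_nhds hul),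
        hF.continuousAt.eventually_mem (hQ.mem_nhds huQ)] with y h1 h2 h3
      exact (hGQ _ ⟨h2, h1⟩ h3).symm
    unfold RegularParam.pullback
    rw [heq.fderiv_eq, fderiv_comp _ _ (hF.differentiableAt (by simp)), Function.comp_apply]
    · beta_reduce
      rw [hGF]
      rfl
    · exact ((hG _ huQ).restrictScalars (𝕜 := ℝ)).contDiffAt.differentiableAt (n := ∞) (by simp)

theorem IsLocalExtension.add {θ θ' : Family V 𝕜 S p} {l : L} {O O' : Set (Fin (V.dim l) → ℂ)}
    {η η' : (Fin (V.dim l) → ℂ) → (Fin (V.dim l) → ℂ) [⋀^Fin p]→L[ℝ] 𝕜}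
    (h : IsLocalExtension θ l O η) (h' : IsLocalExtension θ' l O' η') :
    IsLocalExtension (θ + θ') l (O ∩ O') (η + η') := by
  refine ⟨h.1.inter h'.1, fun z hz ↦ h.2.1 hz.1, (h.2.2.1.mono inter_subset_left).add
    (h'.2.2.1.mono inter_subset_right), fun ψ u hl hO ↦ ?_⟩
  simp only [Family.add_coord]
  rw [h.2.2.2 ψ u hl hO.1, h'.2.2.2 ψ u hl hO.2]
  rfl

theorem IsLocalExtension.smul (c : 𝕜) {θ : Family V 𝕜 S p} {l : L}
    {O : Set (Fin (V.dim l) → ℂ)}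
    {η : (Fin (V.dim l) → ℂ) → (Fin (V.dim l) → ℂ) [⋀^Fin p]→L[ℝ] 𝕜}
    (h : IsLocalExtension θ l O η) : IsLocalExtension (c • θ) l O (c • η) := by
  refine ⟨h.1, h.2.1, contDiffOn_const.smul h.2.2.1, fun ψ u hl hO ↦ ?_⟩
  simp only [Family.smul_coord]
  rw [h.2.2.2 ψ u hl hO]
  rfl

variable (V 𝕜 S p) in
/-- The space of extendable `𝕜`-valued `p`-forms over `S`. For `S` an open subset of `X` it is
`Γ_ext(Λᵖ T^*S')`. -/
def extForms : Submodule 𝕜 (Family V 𝕜 S p) where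
  carrier := {θ | IsSection θ ∧ IsExtendable θ}
  add_mem' := by
    rintro θ θ' ⟨h1, h2⟩ ⟨h1', h2'⟩
    refine ⟨fun ψ φ u v h ↦ ?_, fun x hx ↦ ?_⟩
    · simp only [Family.add_coord]
      rw [h1 ψ φ u v h, h1' ψ φ u v h]
      rfl
    · obtain ⟨l, O, η, hl, hO, he⟩ := h2 x hx
      obtain ⟨k, Q, ζ, hk, hQ, hf⟩ := h2' x hx
      obtain ⟨O', η', hO', he'⟩ := hf.transfer hk hQ hl
      exact ⟨l, O ∩ O', η + η', hl, ⟨hO, hO'⟩, he.add he'⟩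
  zero_mem' := by
    refine ⟨fun ψ φ u v h ↦ rfl, fun x hx ↦ ?_⟩
    obtain ⟨l, hl⟩ := mem_iUnion.1 (V.iUnion_A.symm ▸ mem_univ x)
    exact ⟨l, V.U l, 0, hl, (V.isAnalyticSubset l).1 (mem_image_of_mem _ hl), V.isOpen_U l,
      Subset.rfl, contDiffOn_const, fun ψ u _ _ ↦ rfl⟩
  smul_mem' := by
    rintro c θ ⟨h1, h2⟩
    refine ⟨fun ψ φ u v h ↦ ?_, fun x hx ↦ ?_⟩
    · simp only [Family.smul_coord]
      rw [h1 ψ φ u v h]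
      rfl
    · obtain ⟨l, O, η, hl, hO, he⟩ := h2 x hx
      exact ⟨l, O, _, hl, hO, he.smul c⟩

/-- Restriction of extendable forms to a subset. -/
def res (h : S ⊆ T) : extForms V 𝕜 T p →ₗ[𝕜] extForms V 𝕜 S p where
  toFun θ := ⟨⟨fun ψ u ↦ θ.1.coord ψ ⟨u, u.2.1, h u.2.2⟩⟩,
    fun ψ φ u v e ↦ θ.2.1 ψ φ ⟨u, u.2.1, h u.2.2⟩ ⟨v, v.2.1, h v.2.2⟩ e,
    fun x hx ↦ by
      obtain ⟨l, O, η, hl, hO, he⟩ := θ.2.2 x (h hx)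
      exact ⟨l, O, η, hl, hO, he.1, he.2.1, he.2.2.1,
        fun ψ u ↦ he.2.2.2 ψ ⟨u, u.2.1, h u.2.2⟩⟩⟩
  map_add' _ _ := rfl
  map_smul' _ _ := rfl

/-! ### The exterior differential -/

/-- The coordinate expression of `θ` in the coordinates `ψ`, as a form on `ℂ^(ψ.dim)` (zero outside
`ψ.dom S`). -/
def coordRep (θ : Family V 𝕜 S p) (ψ : RegularParam V) (u : Fin ψ.dim → ℂ) :
    (Fin ψ.dim → ℂ) [⋀^Fin p]→L[ℝ] 𝕜 :=
  open Classical in if h : u ∈ ψ.dom S then θ.coord ψ ⟨u, h⟩ else 0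

theorem minSmoothness_two_le : minSmoothness ℝ 2 ≤ ∞ := by
  rw [minSmoothness_of_isRCLikeNormedField]
  exact WithTop.coe_le_coe.2 (le_top : (2 : ℕ∞) ≤ ⊤)

theorem contDiffOn_extDeriv {E G : Type*} [NormedAddCommGroup E] [NormedSpace ℝ E]
    [NormedAddCommGroup G] [NormedSpace ℝ G] {O : Set E} (hO : IsOpen O)
    {η : E → E [⋀^Fin p]→L[ℝ] G} (h : ContDiffOn ℝ ∞ η O) : ContDiffOn ℝ ∞ (extDeriv η) O :=
  (ContinuousAlternatingMap.alternatizeUncurryFinCLM ℝ E G).contDiff.comp_contDiffOn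
    (h.fderiv_of_isOpen hO (by simp))

theorem RegularParam.continuousAt_pullback (ψ : RegularParam V) {l : L} {u : Fin ψ.dim → ℂ}
    (hu : u ∈ ψ.B) (hl : ψ.toFun u ∈ V.A l)
    {η : (Fin (V.dim l) → ℂ) → (Fin (V.dim l) → ℂ) [⋀^Fin p]→L[ℝ] 𝕜}
    (hη : ContDiffAt ℝ ∞ η (V.F l (ψ.toFun u))) : ContinuousAt (ψ.pullback l η) u := by
  have hF := ψ.contDiffAt_F hu hl
  have h1 : ContDiffAt ℝ ∞ (fun z ↦ η (V.F l (ψ.toFun z))) u := ContDiffAt.comp u hη hF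
  have h2 : ContDiffAt ℝ ∞ (fderiv ℝ (V.F l ∘ ψ.toFun)) u := hF.fderiv_right (by simp)
  exact (contDiff_alt_pullback.contDiffAt.comp u (h1.prodMk h2)).continuousAt

theorem RegularParam.eventually_chart (ψ : RegularParam V) {l : L} {u : Fin ψ.dim → ℂ}
    (hu : u ∈ ψ.B) (hl : ψ.toFun u ∈ V.A l) {O : Set (Fin (V.dim l) → ℂ)} (hO : IsOpen O)
    (huO : V.F l (ψ.toFun u) ∈ O) :
    ∀ᶠ z in 𝓝 u, z ∈ ψ.B ∧ ψ.toFun z ∈ V.A l ∧ V.F l (ψ.toFun z) ∈ O := by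
  filter_upwards [ψ.isOpen_B.mem_nhds hu,
    (ψ.continuousAt hu).eventually_mem ((V.isOpen_A l).mem_nhds hl),
    (ψ.contDiffAt_F hu hl).continuousAt.eventually_mem (hO.mem_nhds huO)] with z h1 h2 h3
  exact ⟨h1, h2, h3⟩

/-- In the interior of `S` the exterior derivative of the coordinate expressions of `θ` is the pull
back of the exterior derivative of any local extension. -/
theorem IsLocalExtension.extDeriv_coordRep {θ : Family V 𝕜 S p} {l : L}
    {O : Set (Fin (V.dim l) → ℂ)}
    {η : (Fin (V.dim l) → ℂ) → (Fin (V.dim l) → ℂ) [⋀^Fin p]→L[ℝ] 𝕜}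
    (h : IsLocalExtension θ l O η) (ψ : RegularParam V) {u : Fin ψ.dim → ℂ}
    (hu : u ∈ ψ.dom (interior S)) (hl : ψ.toFun u ∈ V.A l) (hO : V.F l (ψ.toFun u) ∈ O) :
    extDeriv (coordRep θ ψ) u = ψ.pullback l (extDeriv η) u := by
  have heq : coordRep θ ψ =ᶠ[𝓝 u] ψ.pullback l η := by
    filter_upwards [ψ.eventually_chart hu.1 hl h.1 hO,
      (ψ.continuousAt hu.1).eventually_mem (isOpen_interior.mem_nhds hu.2)] with z hz hzS
    have hz' : z ∈ ψ.dom S := ⟨hz.1, interior_subset hzS⟩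
    rw [coordRep, dif_pos hz']
    exact h.2.2.2 ψ ⟨z, hz'⟩ hz.2.1 hz.2.2
  rw [heq.extDeriv_eq]
  exact extDeriv_pullback (r := ∞)
    ((h.2.2.1.contDiffAt (h.1.mem_nhds hO)).differentiableAt (by simp))
    (ψ.contDiffAt_F hu.1 hl) minSmoothness_two_le

theorem RegularParam.mem_closure_dom (ψ : RegularParam V) (hS : S ⊆ closure (interior S))
    {u : Fin ψ.dim → ℂ} (hu : u ∈ ψ.dom S) : u ∈ closure (ψ.dom (interior S)) := by
  rw [mem_closure_iff]
  intro N hN huN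
  have ho : IsOpen (ψ.B.domRestrict ψ.toFun '' (Subtype.val ⁻¹' N)) :=
    ψ.isOpenEmbedding.isOpenMap _ (hN.preimage continuous_subtype_val)
  obtain ⟨y, ⟨z, hz, rfl⟩, hy⟩ := mem_closure_iff.1 (hS hu.2) _ ho ⟨⟨u, hu.1⟩, huN, rfl⟩
  exact ⟨z, hz, z.2, hy⟩

/-- If `S` is contained in the closure of its interior, the differential of a local extension
depends, at the points of `S ∩ X'` and after pull back, only on the extended form. -/
theorem IsLocalExtension.unique (hS : S ⊆ closure (interior S)) {θ : Family V 𝕜 S p} {l k : L}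
    {O : Set (Fin (V.dim l) → ℂ)} {Q : Set (Fin (V.dim k) → ℂ)}
    {η : (Fin (V.dim l) → ℂ) → (Fin (V.dim l) → ℂ) [⋀^Fin p]→L[ℝ] 𝕜}
    {ζ : (Fin (V.dim k) → ℂ) → (Fin (V.dim k) → ℂ) [⋀^Fin p]→L[ℝ] 𝕜}
    (h : IsLocalExtension θ l O η) (h' : IsLocalExtension θ k Q ζ) (ψ : RegularParam V)
    {u : Fin ψ.dim → ℂ} (hu : u ∈ ψ.dom S) (hl : ψ.toFun u ∈ V.A l)
    (hO : V.F l (ψ.toFun u) ∈ O) (hk : ψ.toFun u ∈ V.A k) (hQ : V.F k (ψ.toFun u) ∈ Q) :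
    ψ.pullback l (extDeriv η) u = ψ.pullback k (extDeriv ζ) u := by
  have : (𝓝[ψ.dom (interior S)] u).NeBot :=
    mem_closure_iff_nhdsWithin_neBot.1 (ψ.mem_closure_dom hS hu)
  have c1 : ContinuousAt (ψ.pullback l (extDeriv η)) u := ψ.continuousAt_pullback hu.1 hl
    ((contDiffOn_extDeriv h.1 h.2.2.1).contDiffAt (h.1.mem_nhds hO))
  have c2 : ContinuousAt (ψ.pullback k (extDeriv ζ)) u := ψ.continuousAt_pullback hu.1 hk
    ((contDiffOn_extDeriv h'.1 h'.2.2.1).contDiffAt (h'.1.mem_nhds hQ))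
  refine tendsto_nhds_unique_of_eventuallyEq (c1.mono_left (nhdsWithin_le_nhds
    (s := ψ.dom (interior S)))) (c2.mono_left nhdsWithin_le_nhds) ?_
  filter_upwards [nhdsWithin_le_nhds (ψ.eventually_chart hu.1 hl h.1 hO),
    nhdsWithin_le_nhds (ψ.eventually_chart hu.1 hk h'.1 hQ), self_mem_nhdsWithin] with z h1 h2 h3
  rw [← h.extDeriv_coordRep ψ h3 h1.2.1 h1.2.2, ← h'.extDeriv_coordRep ψ h3 h2.2.1 h2.2.2]

/-- The exterior differential of an extendable form: around each point, the pull back of the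
exterior derivative of a local extension of the form. -/
def extd (θ : Family V 𝕜 S p) (h : IsExtendable θ) : Family V 𝕜 S (p + 1) where
  coord ψ u := ψ.pullback (h (ψ.toFun u) u.2.2).choose
    (extDeriv (h (ψ.toFun u) u.2.2).choose_spec.choose_spec.choose) u

/-- The differential can be computed from any local extension. -/
theorem IsLocalExtension.extd (hS : S ⊆ closure (interior S)) {θ : Family V 𝕜 S p}
    (hθ : IsExtendable θ) {l : L} {O : Set (Fin (V.dim l) → ℂ)}
    {η : (Fin (V.dim l) → ℂ) → (Fin (V.dim l) → ℂ) [⋀^Fin p]→L[ℝ] 𝕜}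
    (h : IsLocalExtension θ l O η) : IsLocalExtension (extd θ hθ) l O (extDeriv η) := by
  refine ⟨h.1, h.2.1, contDiffOn_extDeriv h.1 h.2.2.1, fun ψ u hl hO ↦ ?_⟩
  obtain ⟨h1, h2, h3⟩ := (hθ (ψ.toFun u) u.2.2).choose_spec.choose_spec.choose_spec
  exact h3.unique hS h ψ u.2 h1 h2 hl hO

/-- In the interior of `S`, in particular everywhere if `S` is open, the differential is the usual
exterior differential of forms on the manifold `X'`, computed in local coordinates. -/
theorem extd_eq_extDeriv {θ : Family V 𝕜 S p} (hθ : IsExtendable θ) (ψ : RegularParam V)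
    (u : ψ.dom S) (hu : ψ.toFun u ∈ interior S) :
    (extd θ hθ).coord ψ u = extDeriv (coordRep θ ψ) u := by
  obtain ⟨h1, h2, h3⟩ := (hθ (ψ.toFun u) u.2.2).choose_spec.choose_spec.choose_spec
  exact (h3.extDeriv_coordRep ψ ⟨u.2.1, hu⟩ h1 h2).symm

theorem isSection_extd (hS : S ⊆ closure (interior S)) {θ : Family V 𝕜 S p}
    (hθ : IsExtendable θ) : IsSection (extd θ hθ) := by
  intro ψ φ u v huv
  obtain ⟨l, O, η, hl, hO, he⟩ := hθ (ψ.toFun u) u.2.2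
  have hd := he.extd hS hθ
  have h1 := hd.2.2.2 ψ u hl hO
  have hl' : φ.toFun v ∈ V.A l := by rw [← huv]; exact hl
  have hO' : V.F l (φ.toFun v) ∈ O := by rw [← huv]; exact hO
  have h2 := hd.2.2.2 φ v hl' hO'
  rw [h1, h2]
  exact ψ.pullback_change φ u.2.1 v.2.1 huv hl _

theorem isExtendable_extd (hS : S ⊆ closure (interior S)) {θ : Family V 𝕜 S p}
    (hθ : IsExtendable θ) : IsExtendable (extd θ hθ) := by
  intro x hx
  obtain ⟨l, O, η, hl, hO, he⟩ := hθ x hx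
  exact ⟨l, O, extDeriv η, hl, hO, he.extd hS hθ⟩

theorem extd_add (hS : S ⊆ closure (interior S)) {θ θ' : Family V 𝕜 S p}
    (hθ : IsExtendable θ) (hθ' : IsExtendable θ') (h : IsExtendable (θ + θ')) :
    extd (θ + θ') h = extd θ hθ + extd θ' hθ' := by
  refine Family.ext (funext fun ψ ↦ funext fun u ↦ ?_)
  obtain ⟨l, O, η, hl, hO, he⟩ := hθ (ψ.toFun u) u.2.2
  obtain ⟨k, Q, ζ, hk, hQ, hf⟩ := hθ' (ψ.toFun u) u.2.2
  obtain ⟨O', η', hO', he'⟩ := hf.transfer hk hQ hl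
  have h1 := (he.extd hS hθ).2.2.2 ψ u hl hO
  have h2 := (he'.extd hS hθ').2.2.2 ψ u hl hO'
  have h3 := ((he.add he').extd hS h).2.2.2 ψ u hl ⟨hO, hO'⟩
  simp only [Family.add_coord]
  rw [h1, h2, h3]
  unfold RegularParam.pullback
  rw [extDeriv_add ((he.2.2.1.contDiffAt (he.1.mem_nhds hO)).differentiableAt (by simp))
    ((he'.2.2.1.contDiffAt (he'.1.mem_nhds hO')).differentiableAt (by simp))]
  rfl

theorem extd_smul (hS : S ⊆ closure (interior S)) (c : 𝕜) {θ : Family V 𝕜 S p}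
    (hθ : IsExtendable θ) (h : IsExtendable (c • θ)) :
    extd (c • θ) h = c • extd θ hθ := by
  refine Family.ext (funext fun ψ ↦ funext fun u ↦ ?_)
  obtain ⟨l, O, η, hl, hO, he⟩ := hθ (ψ.toFun u) u.2.2
  have h1 := (he.extd hS hθ).2.2.2 ψ u hl hO
  have h3 := ((he.smul c).extd hS h).2.2.2 ψ u hl hO
  simp only [Family.smul_coord]
  rw [h1, h3]
  unfold RegularParam.pullback extDeriv
  rw [fderiv_const_smul ((he.2.2.1.contDiffAt (he.1.mem_nhds hO)).differentiableAt (by simp)),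
    ContinuousAlternatingMap.alternatizeUncurryFin_smul]
  rfl

/-- The exterior differential `d : Γ_ext(Λᵖ) → Γ_ext(Λᵖ⁺¹)` over a set `S` contained in the closure
of its interior (below: an open set, or the closure of an open set). -/
def d (hS : S ⊆ closure (interior S)) (p : ℕ) :
    extForms V 𝕜 S p →ₗ[𝕜] extForms V 𝕜 S (p + 1) where
  toFun θ := ⟨extd θ.1 θ.2.2, isSection_extd hS θ.2.2, isExtendable_extd hS θ.2.2⟩
  map_add' θ θ' := Subtype.ext (extd_add hS θ.2.2 θ'.2.2 (θ + θ').2.2)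
  map_smul' c θ := Subtype.ext (extd_smul hS c θ.2.2 (c • θ).2.2)

theorem d_res (hS : S ⊆ closure (interior S)) (hT : T ⊆ closure (interior T)) (h : S ⊆ T)
    (θ : extForms V 𝕜 T p) : d hS p (res h θ) = res h (d hT p θ) := by
  refine Subtype.ext (Family.ext (funext fun ψ ↦ funext fun u ↦ ?_))
  obtain ⟨l, O, η, hl, hO, he⟩ := θ.2.2 (ψ.toFun u) (h u.2.2)
  have he' : IsLocalExtension (res h θ).1 l O η :=
    ⟨he.1, he.2.1, he.2.2.1, fun ψ u ↦ he.2.2.2 ψ ⟨u, u.2.1, h u.2.2⟩⟩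
  refine ((he'.extd hS (res h θ).2.2).2.2.2 ψ u hl hO).trans ?_
  exact ((he.extd hT θ.2.2).2.2.2 ψ ⟨u, u.2.1, h u.2.2⟩ hl hO).symm

theorem d_d (hS : S ⊆ closure (interior S)) (θ : extForms V 𝕜 S p) :
    d hS (p + 1) (d hS p θ) = 0 := by
  refine Subtype.ext (Family.ext (funext fun ψ ↦ funext fun u ↦ ?_))
  obtain ⟨l, O, η, hl, hO, he⟩ := θ.2.2 (ψ.toFun u) u.2.2
  refine (((he.extd hS θ.2.2).extd hS (d hS p θ).2.2).2.2.2 ψ u hl hO).trans ?_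
  unfold RegularParam.pullback
  rw [extDeriv_extDeriv_apply (he.2.2.1.contDiffAt (he.1.mem_nhds hO))
    minSmoothness_two_le]
  rfl

end Forms

/-! ### Cohomology of a complex `M 0 → M 1 → M 2 → ⋯` -/

section Cohomology

variable {R : Type*} [Ring R] {M N : ℕ → Type*}
  [∀ r, AddCommGroup (M r)] [∀ r, Module R (M r)] [∀ r, AddCommGroup (N r)] [∀ r, Module R (N r)]

/-- `Zʳ`, the kernel of the differential. -/
def cocycles (dM : (r : ℕ) → M r →ₗ[R] M (r + 1)) (r : ℕ) : Submodule R (M r) :=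
  LinearMap.ker (dM r)

/-- `Bʳ`, the image of the preceding differential (zero for `r = 0`). -/
def coboundaries (dM : (r : ℕ) → M r →ₗ[R] M (r + 1)) : (r : ℕ) → Submodule R (M r)
  | 0 => ⊥
  | r + 1 => LinearMap.range (dM r)

/-- `Hʳ = Zʳ / Bʳ`. -/
abbrev Cohomology (dM : (r : ℕ) → M r →ₗ[R] M (r + 1)) (r : ℕ) :=
  cocycles dM r ⧸ (coboundaries dM r).submoduleOf (cocycles dM r)

/-- The map in cohomology induced by a cochain map. -/
def Cohomology.map {dM : (r : ℕ) → M r →ₗ[R] M (r + 1)} {dN : (r : ℕ) → N r →ₗ[R] N (r + 1)}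
    (f : (r : ℕ) → M r →ₗ[R] N r) (hf : ∀ r x, f (r + 1) (dM r x) = dN r (f r x)) (r : ℕ) :
    Cohomology dM r →ₗ[R] Cohomology dN r :=
  Submodule.mapQ _ _
    ((f r).restrict (p := cocycles dM r) (q := cocycles dN r) fun x hx ↦ by
      have hx' : dM r x = 0 := hx
      change dN r (f r x) = 0
      rw [← hf, hx', map_zero])
    (by
      rintro ⟨x, hx⟩ hxB
      change x ∈ coboundaries dM r at hxB
      change f r x ∈ coboundaries dN r
      cases r with
      | zero =>
        have : x = 0 := hxB
        rw [this, map_zero]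
        exact Submodule.zero_mem _
      | succ r =>
        obtain ⟨y, rfl⟩ := hxB
        exact ⟨f r y, (hf r y).symm⟩)

end Cohomology

/-! ### Extendable cohomology relative to `Z` -/

section Relative

variable {𝕜 : Type*} [RCLike 𝕜] {S T Z : Set X} {p : ℕ}

/-- `Z` is either empty or the closure of a non-empty open set. -/
def IsEmptyOrClosureOfOpen (Z : Set X) : Prop :=
  Z = ∅ ∨ ∃ O : Set X, IsOpen O ∧ O.Nonempty ∧ Z = closure O

theorem IsEmptyOrClosureOfOpen.subset (hZ : IsEmptyOrClosureOfOpen Z) :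
    Z ⊆ closure (interior Z) := by
  rcases hZ with rfl | ⟨O, hO, -, rfl⟩
  · exact empty_subset _
  · exact closure_mono (interior_maximal subset_closure hO)

theorem subset_of_isOpen (hS : IsOpen S) : S ⊆ closure (interior S) := by
  rw [hS.interior_eq]
  exact subset_closure

theorem IsEmptyOrClosureOfOpen.inter_subset (hZ : IsEmptyOrClosureOfOpen Z) (hS : IsOpen S) :
    S ∩ Z ⊆ closure (interior (S ∩ Z)) := by
  rw [interior_inter, hS.interior_eq]
  exact (inter_subset_inter_right S hZ.subset).trans hS.inter_closure

variable (V 𝕜 S Z p) in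
/-- `Γ_ext(Λᵖ T^*S')_Z`: the extendable `p`-forms over `S` that vanish on `Z`. -/
def vanishingForms : Submodule 𝕜 (extForms V 𝕜 S p) :=
  LinearMap.ker (res (inter_subset_left : S ∩ Z ⊆ S))

/-- Restriction of forms vanishing on `Z`. -/
def vanishingRes (h : S ⊆ T) : vanishingForms V 𝕜 T Z p →ₗ[𝕜] vanishingForms V 𝕜 S Z p :=
  (res h).restrict fun θ hθ ↦ by
    change res inter_subset_left (res h θ) = 0
    have hθ' : res (inter_subset_left : T ∩ Z ⊆ T) θ = 0 := hθ
    change res (inter_subset_inter_left Z h) (res inter_subset_left θ) = 0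
    rw [hθ', map_zero]

/-- The exterior differential of forms vanishing on `Z`, over an open set `S`. -/
def vanishingD (hS : IsOpen S) (hZ : IsEmptyOrClosureOfOpen Z) (p : ℕ) :
    vanishingForms V 𝕜 S Z p →ₗ[𝕜] vanishingForms V 𝕜 S Z (p + 1) :=
  (d (subset_of_isOpen hS) p).restrict fun θ hθ ↦ by
    have hθ' : res (inter_subset_left : S ∩ Z ⊆ S) θ = 0 := hθ
    change res inter_subset_left (d (subset_of_isOpen hS) p θ) = 0
    rw [← d_res (hZ.inter_subset hS), hθ', map_zero]

/-- `H_ext^r(X)_Z`, the cohomology of the complex of extendable forms vanishing on `Z`. -/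
abbrev VanishingCohomology (V : AnalyticVariety L X) (𝕜 : Type*) [RCLike 𝕜]
    (hZ : IsEmptyOrClosureOfOpen Z) (r : ℕ) :=
  Cohomology (R := 𝕜) (M := fun p ↦ vanishingForms V 𝕜 univ Z p)
    (fun p ↦ vanishingD isOpen_univ hZ p) r

variable (V 𝕜 Z) in
/-- The extendable forms over `Z` of degree `p - 1` (zero for `p = 0`): sections over `Z ∩ X'` of
the pull back of `Λᵖ⁻¹ T^*X'` to `Z ∩ X'`, extendable around every point of `Z`. -/
def PrevForms : ℕ → Type _
  | 0 => PUnit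
  | p + 1 => extForms V 𝕜 Z p

instance PrevForms.instAddCommGroup : (p : ℕ) → AddCommGroup (PrevForms V 𝕜 Z p)
  | 0 => (inferInstance : AddCommGroup PUnit)
  | p + 1 => (inferInstance : AddCommGroup (extForms V 𝕜 Z p))

instance PrevForms.instModule : (p : ℕ) → Module 𝕜 (PrevForms V 𝕜 Z p)
  | 0 => PUnit.module
  | p + 1 => (inferInstance : Module 𝕜 (extForms V 𝕜 Z p))

/-- The exterior differential `d^(p-1)` of forms over `Z`. -/
def PrevForms.d (hZ : IsEmptyOrClosureOfOpen Z) :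
    (p : ℕ) → PrevForms V 𝕜 Z p →ₗ[𝕜] extForms V 𝕜 Z p
  | 0 => 0
  | p + 1 => ExtendableForms.d hZ.subset p

variable (V 𝕜 Z) in
/-- The extendable `p`-forms relative to the pair `(X, Z)`: pairs of an extendable `p`-form on `X`
and an extendable `(p - 1)`-form over `Z`. -/
abbrev PairForms (p : ℕ) := extForms V 𝕜 univ p × PrevForms V 𝕜 Z p

/-- The differential `(κ, υ) ↦ (dκ, κ|_Z - dυ)`. -/
def pairD (hZ : IsEmptyOrClosureOfOpen Z) (p : ℕ) :
    PairForms V 𝕜 Z p →ₗ[𝕜] PairForms V 𝕜 Z (p + 1) :=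
  LinearMap.prod
    (d (subset_of_isOpen isOpen_univ) p ∘ₗ LinearMap.fst 𝕜 (extForms V 𝕜 univ p) (PrevForms V 𝕜 Z p))
    (res (subset_univ Z) ∘ₗ LinearMap.fst 𝕜 (extForms V 𝕜 univ p) (PrevForms V 𝕜 Z p) -
      PrevForms.d hZ p ∘ₗ LinearMap.snd 𝕜 (extForms V 𝕜 univ p) (PrevForms V 𝕜 Z p))

/-- `H_ext^r(X, Z)`, the extendable cohomology relative to the pair `(X, Z)`. -/
abbrev PairCohomology (V : AnalyticVariety L X) (𝕜 : Type*) [RCLike 𝕜]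
    (hZ : IsEmptyOrClosureOfOpen Z) (r : ℕ) :=
  Cohomology (R := 𝕜) (M := fun p ↦ PairForms V 𝕜 Z p) (fun p ↦ pairD hZ p) r

variable (V 𝕜 Z p) in
/-- The map `α : ω ↦ (ω, 0)` from forms vanishing on `Z` to forms relative to `(X, Z)`. -/
def toPair : vanishingForms V 𝕜 univ Z p →ₗ[𝕜] PairForms V 𝕜 Z p :=
  LinearMap.prod (vanishingForms V 𝕜 univ Z p).subtype 0

theorem toPair_d (hZ : IsEmptyOrClosureOfOpen Z) (p : ℕ) (θ : vanishingForms V 𝕜 univ Z p) :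
    toPair V 𝕜 Z (p + 1) (vanishingD isOpen_univ hZ p θ) = pairD hZ p (toPair V 𝕜 Z p θ) := by
  refine Prod.ext rfl ?_
  change (0 : extForms V 𝕜 Z p) = res (subset_univ Z) θ.1 - PrevForms.d hZ p 0
  have hθ : res (inter_subset_left : univ ∩ Z ⊆ univ) θ.1 = 0 := θ.2
  have hZ' : res (subset_univ Z) θ.1 = 0 :=
    (congrArg (res (subset_inter (subset_univ Z) Subset.rfl)) hθ).trans (LinearMap.map_zero _)
  rw [hZ', LinearMap.map_zero, sub_zero]

/-- The canonical map `A^r : H_ext^r(X)_Z → H_ext^r(X, Z)`, `[ω] ↦ [(ω, 0)]`. -/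
def toPairCohomology (V : AnalyticVariety L X) (𝕜 : Type*) [RCLike 𝕜]
    (hZ : IsEmptyOrClosureOfOpen Z) (r : ℕ) :
    VanishingCohomology V 𝕜 hZ r →ₗ[𝕜] PairCohomology V 𝕜 hZ r :=
  Cohomology.map (toPair V 𝕜 Z) (toPair_d hZ) r

end Relative

/-! ### The extendable Čech–de Rham complex -/

section Cech

variable {𝕜 : Type*} [RCLike 𝕜] {J : Type*} {Z : Set X}

/-- The covering `𝒱` is adapted to `Z`: either `Z` is empty, or `Z` is contained in one member
`𝒱 j₀` of `𝒱` and disjoint from all the others. -/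
def IsAdapted (𝒱 : J → TopologicalSpace.Opens X) (Z : Set X) : Prop :=
  Z = ∅ ∨ ∃ j₀, Z ⊆ 𝒱 j₀ ∧ ∀ j, j ≠ j₀ → Disjoint Z (𝒱 j)

/-- The intersection `𝒱 j₀ ∩ ⋯ ∩ 𝒱 j_q`. -/
def cechInter (𝒱 : J → TopologicalSpace.Opens X) {q : ℕ} (j : Fin (q + 1) → J) : Set X :=
  ⋂ m, (𝒱 (j m) : Set X)

theorem isOpen_cechInter (𝒱 : J → TopologicalSpace.Opens X) {q : ℕ} (j : Fin (q + 1) → J) :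
    IsOpen (cechInter 𝒱 j) :=
  isOpen_iInter_of_finite fun m ↦ (𝒱 (j m)).isOpen

theorem cechInter_subset (𝒱 : J → TopologicalSpace.Opens X) {q : ℕ} (j : Fin (q + 2) → J)
    (m : Fin (q + 2)) : cechInter 𝒱 j ⊆ cechInter 𝒱 (j ∘ m.succAbove) :=
  subset_iInter fun k ↦ iInter_subset _ (m.succAbove k)

variable (V 𝕜) in
/-- `C_q^p(X, 𝒱, V_Z)`: families, indexed by all the `(q+1)`-tuples of indices, of extendable
`p`-forms on the intersections of the members of `𝒱`, vanishing on `Z`. -/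
abbrev CechForms (𝒱 : J → TopologicalSpace.Opens X) (Z : Set X) (p q : ℕ) :=
  (j : Fin (q + 1) → J) → vanishingForms V 𝕜 (cechInter 𝒱 j) Z p

/-- The difference operator `(δω)_j = ∑ (-1)^m ω_(j₀ … ĵ_m … j_(q+1))`. -/
def cechδ (𝒱 : J → TopologicalSpace.Opens X) (Z : Set X) (p q : ℕ) :
    CechForms V 𝕜 𝒱 Z p q →ₗ[𝕜] CechForms V 𝕜 𝒱 Z p (q + 1) :=
  LinearMap.pi fun j ↦ ∑ m : Fin (q + 2), (-1 : 𝕜) ^ (m : ℕ) •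
    (vanishingRes (cechInter_subset 𝒱 j m) ∘ₗ LinearMap.proj (j ∘ m.succAbove))

/-- The exterior differential on `C_q^p(X, 𝒱, V_Z)`. -/
def cechd (𝒱 : J → TopologicalSpace.Opens X) (hZ : IsEmptyOrClosureOfOpen Z) (p q : ℕ) :
    CechForms V 𝕜 𝒱 Z p q →ₗ[𝕜] CechForms V 𝕜 𝒱 Z (p + 1) q :=
  LinearMap.pi fun j ↦ vanishingD (isOpen_cechInter 𝒱 j) hZ p ∘ₗ LinearMap.proj j

variable (V 𝕜) in
/-- `K^r(X, 𝒱, V_Z)`, the direct sum of the `C_q^p(X, 𝒱, V_Z)` with `p + q = r`. -/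
abbrev CechTotal (𝒱 : J → TopologicalSpace.Opens X) (Z : Set X) (r : ℕ) :=
  (a : {a : ℕ × ℕ // a.1 + a.2 = r}) → CechForms V 𝕜 𝒱 Z a.1.1 a.1.2

/-- The component in `C_q^p` of the difference of an element of `K^r`, `p + q = r + 1`. -/
def totalδ (𝒱 : J → TopologicalSpace.Opens X) (Z : Set X) (r : ℕ) :
    (p q : ℕ) → p + q = r + 1 → CechTotal V 𝕜 𝒱 Z r →ₗ[𝕜] CechForms V 𝕜 𝒱 Z p q
  | _, 0, _ => 0
  | p, q + 1, h => cechδ 𝒱 Z p q ∘ₗ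
      (LinearMap.proj (R := 𝕜) (φ := fun a : {a : ℕ × ℕ // a.1 + a.2 = r} ↦
        CechForms V 𝕜 𝒱 Z a.1.1 a.1.2) ⟨(p, q), Nat.succ.inj h⟩)

/-- The component in `C_q^p` of the exterior differential of an element of `K^r`,
`p + q = r + 1`. -/
def totald (𝒱 : J → TopologicalSpace.Opens X) (hZ : IsEmptyOrClosureOfOpen Z) (r : ℕ) :
    (p q : ℕ) → p + q = r + 1 → CechTotal V 𝕜 𝒱 Z r →ₗ[𝕜] CechForms V 𝕜 𝒱 Z p q
  | 0, _, _ => 0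
  | p + 1, q, h => cechd 𝒱 hZ p q ∘ₗ
      (LinearMap.proj (R := 𝕜) (φ := fun a : {a : ℕ × ℕ // a.1 + a.2 = r} ↦
        CechForms V 𝕜 𝒱 Z a.1.1 a.1.2) ⟨(p, q), by change p + q = r; omega⟩)

/-- The total differential `D = δ + (-1)^q d` on `C_q^p`, `p + q = r`. -/
def totalD (𝒱 : J → TopologicalSpace.Opens X) (hZ : IsEmptyOrClosureOfOpen Z) (r : ℕ) :
    CechTotal V 𝕜 𝒱 Z r →ₗ[𝕜] CechTotal V 𝕜 𝒱 Z (r + 1) :=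
  LinearMap.pi fun a ↦
    totalδ (V := V) (𝕜 := 𝕜) 𝒱 Z r a.1.1 a.1.2 a.2 +
      (-1 : 𝕜) ^ a.1.2 • totald (V := V) (𝕜 := 𝕜) 𝒱 hZ r a.1.1 a.1.2 a.2

/-- `Ȟ_ext^r(X, 𝒱, V_Z)`, the extendable Čech cohomology. -/
abbrev CechCohomology (V : AnalyticVariety L X) (𝕜 : Type*) [RCLike 𝕜]
    (𝒱 : J → TopologicalSpace.Opens X) (hZ : IsEmptyOrClosureOfOpen Z) (r : ℕ) :=
  Cohomology (R := 𝕜) (M := fun s ↦ CechTotal V 𝕜 𝒱 Z s) (fun s ↦ totalD 𝒱 hZ s) r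

/-- The restriction map `P^p` to `C_0^p(X, 𝒱, V_Z)`. -/
def cechRes (𝒱 : J → TopologicalSpace.Opens X) (Z : Set X) (p : ℕ) :
    vanishingForms V 𝕜 univ Z p →ₗ[𝕜] CechForms V 𝕜 𝒱 Z p 0 :=
  LinearMap.pi fun _ ↦ vanishingRes (subset_univ _)

/-- The component in `C_q^p` of the restriction of an `r`-form, `p + q = r`. -/
def totalResAux (𝒱 : J → TopologicalSpace.Opens X) (Z : Set X) :
    (r p q : ℕ) → p + q = r → vanishingForms V 𝕜 univ Z r →ₗ[𝕜] CechForms V 𝕜 𝒱 Z p q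
  | _, p, 0, rfl => cechRes 𝒱 Z p
  | _, _, _ + 1, _ => 0

/-- The restriction map `P^r : Γ_ext(Λʳ T^*X')_Z → K^r(X, 𝒱, V_Z)`. -/
def totalRes (𝒱 : J → TopologicalSpace.Opens X) (Z : Set X) (r : ℕ) :
    vanishingForms V 𝕜 univ Z r →ₗ[𝕜] CechTotal V 𝕜 𝒱 Z r :=
  LinearMap.pi fun a ↦ totalResAux 𝒱 Z r a.1.1 a.1.2 a.2

theorem cechδ_cechRes (𝒱 : J → TopologicalSpace.Opens X) (p : ℕ)
    (θ : vanishingForms V 𝕜 univ Z p) : cechδ 𝒱 Z p 0 (cechRes 𝒱 Z p θ) = 0 := by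
  funext j
  have h : ∀ m : Fin 2, (vanishingRes (cechInter_subset 𝒱 j m)
      (cechRes 𝒱 Z p θ (j ∘ m.succAbove)) : vanishingForms V 𝕜 (cechInter 𝒱 j) Z p) =
        vanishingRes (subset_univ _) θ := fun _ ↦ rfl
  simp only [cechδ, LinearMap.pi_apply, LinearMap.sum_apply, LinearMap.smul_apply,
    LinearMap.comp_apply, LinearMap.proj_apply, h]
  rw [Fin.sum_univ_two]
  simp only [Fin.val_zero, Fin.val_one, pow_zero, pow_one]
  rw [one_smul, neg_one_smul, add_neg_cancel]
  rfl

theorem cechd_cechRes (𝒱 : J → TopologicalSpace.Opens X) (hZ : IsEmptyOrClosureOfOpen Z) (p : ℕ)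
    (θ : vanishingForms V 𝕜 univ Z p) :
    cechd 𝒱 hZ p 0 (cechRes 𝒱 Z p θ) = cechRes 𝒱 Z (p + 1) (vanishingD isOpen_univ hZ p θ) := by
  funext j
  exact Subtype.ext (d_res (subset_of_isOpen (isOpen_cechInter 𝒱 j)) (subset_of_isOpen isOpen_univ)
    (subset_univ _) θ.1)

/-- The restriction map is a cochain map. -/
theorem totalRes_d (𝒱 : J → TopologicalSpace.Opens X) (hZ : IsEmptyOrClosureOfOpen Z) (r : ℕ)
    (θ : vanishingForms V 𝕜 univ Z r) :
    totalRes 𝒱 Z (r + 1) (vanishingD isOpen_univ hZ r θ) = totalD 𝒱 hZ r (totalRes 𝒱 Z r θ) := by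
  funext ⟨⟨p, q⟩, h⟩
  change p + q = r + 1 at h
  change totalResAux 𝒱 Z (r + 1) p q h (vanishingD isOpen_univ hZ r θ) =
    totalδ 𝒱 Z r p q h (totalRes 𝒱 Z r θ) +
      (-1 : 𝕜) ^ q • totald 𝒱 hZ r p q h (totalRes 𝒱 Z r θ)
  match q, p, h with
  | 0, p, h =>
    obtain rfl : p = r + 1 := h
    change cechRes 𝒱 Z (r + 1) (vanishingD isOpen_univ hZ r θ) =
      0 + (-1 : 𝕜) ^ 0 • cechd 𝒱 hZ r 0 (cechRes 𝒱 Z r θ)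
    rw [cechd_cechRes, pow_zero, one_smul]
    exact (zero_add _).symm
  | 1, p, h =>
    obtain rfl : p = r := Nat.succ.inj h
    have h1 : totald 𝒱 hZ p p 1 h (totalRes 𝒱 Z p θ) = 0 := by
      cases p with
      | zero => rfl
      | succ p => exact map_zero (cechd 𝒱 hZ p 1)
    rw [h1, smul_zero, add_zero]
    exact (cechδ_cechRes 𝒱 p θ).symm
  | q + 2, p, h =>
    have h1 : totald 𝒱 hZ r p (q + 2) h (totalRes 𝒱 Z r θ) = 0 := by
      cases p with
      | zero => rfl
      | succ p => exact map_zero (cechd 𝒱 hZ p (q + 2))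
    rw [h1, smul_zero, add_zero]
    exact (map_zero (cechδ 𝒱 Z p (q + 1))).symm

/-- The map `H_ext^r(X)_Z → Ȟ_ext^r(X, 𝒱, V_Z)` induced by `P^r`. -/
def restrictionCohomology (V : AnalyticVariety L X) (𝕜 : Type*) [RCLike 𝕜]
    (𝒱 : J → TopologicalSpace.Opens X) (hZ : IsEmptyOrClosureOfOpen Z) (r : ℕ) :
    VanishingCohomology V 𝕜 hZ r →ₗ[𝕜] CechCohomology V 𝕜 𝒱 hZ r :=
  Cohomology.map (totalRes 𝒱 Z) (totalRes_d 𝒱 hZ) r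

end Cech

end ExtendableForms

end

noncomputable section

namespace ExtendableForms

universe u

section Smooth

variable {L X : Type*} [TopologicalSpace X] {V : AnalyticVariety L X}

/-! ### Charts and neighbourhoods -/

/-! Everything rests on smooth partitions of unity on the singular space `X`
(`AnalyticVariety.exists_partition`). In a chart `X` is locally closed in `ℂⁿ`, hence `X` is locally
compact; it is also Hausdorff and second countable, and bump functions restrict from the ambient
spaces. Extendable forms can be multiplied by smooth functions and glued (`glue`), and vanishing on
`Z` survives gluing.

A first consequence is that every form over the closed set `Z` extends to `X` (`exists_extension`).
Thus `0 → Γ(X)_Z → Γ(X) → Γ(Z) → 0` is exact, and the pair complex, a shifted mapping cone of the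
restriction, has the cohomology of the kernel. Concretely, a pair `(κ, υ)` with `κ|_Z = dυ` is
cohomologous to `(κ - dκ', 0)`, where `κ'` extends `υ` (`exists_extension_prev`).

A second consequence is that the rows of the Čech–de Rham complex, augmented by the global forms,
are exact: `cechRes_injective`, `exists_cechRes_eq` and `exists_cechδ_eq`. The usual zigzag then
removes the components of a cochain one Čech degree at a time, starting from the highest, until a
global form is left (`exists_sub_totalRes_mem`). So restriction to the covering is bijective in
cohomology, and the required isomorphism is this map composed with the inverse of `A^r`. -/

theorem AnalyticVariety.exists_mem_A (V : AnalyticVariety L X) (x : X) : ∃ l, x ∈ V.A l :=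
  mem_iUnion.1 (V.iUnion_A.symm ▸ mem_univ x)

theorem AnalyticVariety.F_mem_U (V : AnalyticVariety L X) {x : X} {l : L} (hl : x ∈ V.A l) :
    V.F l x ∈ V.U l :=
  (V.isAnalyticSubset l).1 (mem_image_of_mem _ hl)

theorem AnalyticVariety.continuousAt_F (V : AnalyticVariety L X) {x : X} {l : L}
    (hl : x ∈ V.A l) : ContinuousAt (V.F l) x :=
  (continuousOn_iff_continuous_domRestrict.2 (V.isEmbedding_F l).continuous).continuousAt
    ((V.isOpen_A l).mem_nhds hl)

/-- Neighbourhoods in `X` contain the traces of open sets of the ambient space of a chart. -/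
theorem AnalyticVariety.exists_isOpen_of_eventually (V : AnalyticVariety L X) {x : X} {l : L}
    (hl : x ∈ V.A l) {q : X → Prop} (hq : ∀ᶠ y in 𝓝 x, q y) :
    ∃ O : Set (Fin (V.dim l) → ℂ), IsOpen O ∧ V.F l x ∈ O ∧ O ⊆ V.U l ∧
      ∀ y ∈ V.A l, V.F l y ∈ O → q y := by
  obtain ⟨M, hMq, hM, hxM⟩ := eventually_nhds_iff.1 hq
  obtain ⟨N, hN, hNM⟩ := (V.isEmbedding_F l).isOpen_iff.1
    (hM.preimage (continuous_subtype_val (p := (· ∈ V.A l))))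
  have hNM' : ∀ y ∈ V.A l, V.F l y ∈ N ↔ y ∈ M := fun y hy ↦ Set.ext_iff.1 hNM ⟨y, hy⟩
  exact ⟨N ∩ V.U l, hN.inter (V.isOpen_U l), ⟨(hNM' x hl).2 hxM, V.F_mem_U hl⟩,
    inter_subset_right, fun y hy hyN ↦ hMq y ((hNM' y hy).1 hyN.1)⟩

/-- Small closed balls in the ambient space of a chart have compact preimages. -/
theorem AnalyticVariety.exists_isCompact_ball (V : AnalyticVariety L X) {x : X} {l : L}
    (hl : x ∈ V.A l) {N : Set X} (hN : N ∈ 𝓝 x) :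
    ∃ ε > 0, IsCompact {y ∈ V.A l | V.F l y ∈ Metric.closedBall (V.F l x) ε} ∧
      {y ∈ V.A l | V.F l y ∈ Metric.closedBall (V.F l x) ε} ⊆ N := by
  obtain ⟨O, hO, hxO, -, hON⟩ := V.exists_isOpen_of_eventually hl hN
  obtain ⟨Q, hQ, hxQ, -, m, f, hf, hW⟩ := (V.isAnalyticSubset l).2 _ (V.F_mem_U hl)
  -- The ball must fit into `O`, so that its preimage lies in `N`, and into `Q`, where the image of
  -- the chart is cut out by the equations `f k = 0`.
  obtain ⟨ε, hε, hεOQ⟩ := Metric.nhds_basis_closedBall.mem_iff.1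
    ((hO.inter hQ).mem_nhds ⟨hxO, hxQ⟩)
  refine ⟨ε, hε, ?_, fun y hy ↦ hON y hy.1 (hεOQ hy.2).1⟩
  have hclosed : IsClosed {z ∈ Metric.closedBall (V.F l x) ε | ∀ k, f k z = 0} := by
    have : {z ∈ Metric.closedBall (V.F l x) ε | ∀ k, f k z = 0} =
        Metric.closedBall (V.F l x) ε ∩ (fun z k ↦ f k z) ⁻¹' {0} := by
      ext z
      simp [funext_iff]
    rw [this]
    refine ContinuousOn.preimage_isClosed_of_isClosed ?_ Metric.isClosed_closedBall
      isClosed_singleton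
    exact continuousOn_pi.2 fun k ↦ (hf k).continuousOn.mono fun z hz ↦ (hεOQ hz).2
  have hcomp : IsCompact {z ∈ Metric.closedBall (V.F l x) ε | ∀ k, f k z = 0} :=
    (isCompact_closedBall _ _).of_isClosed_subset hclosed fun z hz ↦ hz.1
  -- Inside the ball the image of the chart is exactly the compact zero set, so the embedding pulls
  -- compactness back to `X`.
  have himage : (V.A l).domRestrict (V.F l) ''
      (Subtype.val ⁻¹' {y | V.F l y ∈ Metric.closedBall (V.F l x) ε}) =
        {z ∈ Metric.closedBall (V.F l x) ε | ∀ k, f k z = 0} := by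
    ext z
    constructor
    · rintro ⟨y, hy, rfl⟩
      exact ⟨hy, (hW.subset ⟨mem_image_of_mem _ y.2, (hεOQ hy).2⟩).2⟩
    · rintro ⟨hz, hz0⟩
      obtain ⟨⟨y, hy, rfl⟩, -⟩ := hW.superset ⟨(hεOQ hz).2, hz0⟩
      exact ⟨⟨y, hy⟩, hz, rfl⟩
  have := ((V.isEmbedding_F l).isCompact_iff.2 (himage ▸ hcomp)).image continuous_subtype_val
  rwa [Subtype.image_preimage_coe] at this

/-- With the Hausdorff property and second countability this gives the locally compact, σ-compact
setting in which locally finite refinements exist. -/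
theorem AnalyticVariety.weaklyLocallyCompactSpace (V : AnalyticVariety L X) :
    WeaklyLocallyCompactSpace X where
  exists_compact_mem_nhds x := by
    obtain ⟨l, hl⟩ := V.exists_mem_A x
    obtain ⟨ε, hε, hK, -⟩ := V.exists_isCompact_ball hl Filter.univ_mem
    exact ⟨_, hK, Filter.inter_mem ((V.isOpen_A l).mem_nhds hl)
      ((V.continuousAt_F hl).eventually_mem (Metric.closedBall_mem_nhds _ hε))⟩

/-! ### Smooth functions -/

/-- Around `x` the function `f` is the restriction of a smooth function on the ambient space of the
chart `F l`. -/
def SmoothAt (V : AnalyticVariety L X) (f : X → ℝ) (x : X) (l : L) : Prop :=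
  ∃ g : (Fin (V.dim l) → ℂ) → ℝ,
    (∀ᶠ z in 𝓝 (V.F l x), ContDiffAt ℝ ∞ g z) ∧ ∀ᶠ y in 𝓝 x, f y = g (V.F l y)

/-- `f` is locally the restriction of smooth functions on the ambient spaces of the charts. -/
def IsSmooth (V : AnalyticVariety L X) (f : X → ℝ) : Prop :=
  ∀ x l, x ∈ V.A l → SmoothAt V f x l

theorem SmoothAt.congr {f f' : X → ℝ} {x : X} {l : L} (h : SmoothAt V f x l)
    (hf : f' =ᶠ[𝓝 x] f) : SmoothAt V f' x l := by
  obtain ⟨g, hg, hfg⟩ := h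
  exact ⟨g, hg, hf.trans hfg⟩

theorem SmoothAt.const (c : ℝ) (x : X) (l : L) : SmoothAt V (fun _ ↦ c) x l :=
  ⟨fun _ ↦ c, .of_forall fun _ ↦ contDiffAt_const, .of_forall fun _ ↦ rfl⟩

theorem SmoothAt.add {f f' : X → ℝ} {x : X} {l : L} (h : SmoothAt V f x l)
    (h' : SmoothAt V f' x l) : SmoothAt V (fun y ↦ f y + f' y) x l := by
  obtain ⟨g, hg, hfg⟩ := h
  obtain ⟨g', hg', hfg'⟩ := h'
  refine ⟨fun z ↦ g z + g' z, ?_, ?_⟩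
  · filter_upwards [hg, hg'] with z h h' using h.add h'
  · filter_upwards [hfg, hfg'] with y h h' using by rw [h, h']

theorem SmoothAt.mul {f f' : X → ℝ} {x : X} {l : L} (h : SmoothAt V f x l)
    (h' : SmoothAt V f' x l) : SmoothAt V (fun y ↦ f y * f' y) x l := by
  obtain ⟨g, hg, hfg⟩ := h
  obtain ⟨g', hg', hfg'⟩ := h'
  refine ⟨fun z ↦ g z * g' z, ?_, ?_⟩
  · filter_upwards [hg, hg'] with z h h' using h.mul h'
  · filter_upwards [hfg, hfg'] with y h h' using by rw [h, h']

theorem SmoothAt.sum {α : Type*} {f : α → X → ℝ} {x : X} {l : L} (s : Finset α)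
    (h : ∀ a, SmoothAt V (f a) x l) : SmoothAt V (fun y ↦ ∑ a ∈ s, f a y) x l := by
  classical
  induction s using Finset.induction_on with
  | empty => simpa using SmoothAt.const 0 x l
  | insert a s ha ih => simpa only [Finset.sum_insert ha] using (h a).add ih

theorem SmoothAt.inv {f : X → ℝ} {x : X} {l : L} (h : SmoothAt V f x l)
    (hx : f x ≠ 0) : SmoothAt V (fun y ↦ (f y)⁻¹) x l := by
  obtain ⟨g, hg, hfg⟩ := h
  have hgx : g (V.F l x) ≠ 0 := by rwa [← Filter.Eventually.self_of_nhds hfg]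
  refine ⟨fun z ↦ (g z)⁻¹, ?_, ?_⟩
  · filter_upwards [hg, hg.self_of_nhds.continuousAt.eventually_ne hgx] with z h h' using h.inv h'
  · filter_upwards [hfg] with y h using by rw [h]

theorem SmoothAt.continuousAt {f : X → ℝ} {x : X} {l : L} (hl : x ∈ V.A l)
    (h : SmoothAt V f x l) : ContinuousAt f x := by
  obtain ⟨g, hg, hfg⟩ := h
  exact (hg.self_of_nhds.continuousAt.comp (V.continuousAt_F hl)).congr (Filter.EventuallyEq.symm hfg)

/-- Compose the ambient function with a holomorphic extension of the transition map. Smoothness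
therefore needs checking in only one chart around each point. -/
theorem SmoothAt.transfer {f : X → ℝ} {x : X} {k l : L} (hk : x ∈ V.A k) (hl : x ∈ V.A l)
    (h : SmoothAt V f x k) : SmoothAt V f x l := by
  obtain ⟨g, hg, hfg⟩ := h
  obtain ⟨O, hO, hxO, G, hG, hGO⟩ := V.holomorphic_transition l k x ⟨hl, hk⟩
  have hGc : ∀ z ∈ O, ContDiffAt ℝ ∞ G z := fun z hz ↦
    ((hG z hz).restrictScalars (𝕜 := ℝ)).contDiffAt
  have hGx : Filter.Tendsto G (𝓝 (V.F l x)) (𝓝 (V.F k x)) := by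
    have := (hGc _ hxO).continuousAt
    rwa [ContinuousAt, hGO x ⟨hl, hk⟩ hxO] at this
  refine ⟨g ∘ G, ?_, ?_⟩
  · filter_upwards [hGx.eventually hg, hO.mem_nhds hxO] with z h hz using h.comp z (hGc z hz)
  · filter_upwards [hfg, (V.isOpen_A l).mem_nhds hl, (V.isOpen_A k).mem_nhds hk,
      (V.continuousAt_F hl).eventually_mem (hO.mem_nhds hxO)] with y h h1 h2 h3
    rw [h, Function.comp_apply, hGO y ⟨h1, h2⟩ h3]

theorem IsSmooth.continuous {f : X → ℝ} (h : IsSmooth V f) : Continuous f :=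
  continuous_iff_continuousAt.2 fun x ↦
    let ⟨l, hl⟩ := V.exists_mem_A x
    (h x l hl).continuousAt hl

/-- Smooth bump functions on `X`. -/
theorem AnalyticVariety.exists_bump (V : AnalyticVariety L X) {x : X} {N : Set X} (hN : N ∈ 𝓝 x) :
    ∃ f : X → ℝ, IsSmooth V f ∧ (∀ y, 0 ≤ f y) ∧ f x ≠ 0 ∧ tsupport f ⊆ N := by
  classical
  have := V.t2Space
  obtain ⟨l, hl⟩ := V.exists_mem_A x
  obtain ⟨ε, hε, hK, hKN⟩ := V.exists_isCompact_ball hl hN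
  set K := {y ∈ V.A l | V.F l y ∈ Metric.closedBall (V.F l x) ε}
  let b : ContDiffBump (V.F l x) := ⟨ε / 2, ε, by positivity, by linarith⟩
  let f : X → ℝ := (V.A l).indicator (b ∘ V.F l)
  have hfK : Function.support f ⊆ K := by
    intro y hy
    have hyl : y ∈ V.A l := mem_of_indicator_ne_zero hy
    refine ⟨hyl, Metric.ball_subset_closedBall ?_⟩
    rw [← b.support_eq]
    simpa [f, hyl] using hy
  -- `K` is compact in a Hausdorff space, hence closed in all of `X` and not merely in the chart
  -- domain. This makes the extension of `b ∘ V.F l` by zero smooth.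
  have hfK' : tsupport f ⊆ K := closure_minimal hfK hK.isClosed
  refine ⟨f, fun y k hk ↦ ?_, fun y ↦ indicator_nonneg (fun _ _ ↦ b.nonneg) _, ?_,
    hfK'.trans hKN⟩
  · by_cases hy : y ∈ K
    · refine SmoothAt.transfer hy.1 hk ⟨b, .of_forall fun z ↦ b.contDiff.contDiffAt, ?_⟩
      filter_upwards [(V.isOpen_A l).mem_nhds hy.1] with y' hy'
      simp [f, hy']
    · refine (SmoothAt.const 0 y k).congr ?_
      exact notMem_tsupport_iff_eventuallyEq.1 fun h ↦ hy (hfK' h)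
  · have : b (V.F l x) = 1 := b.one_of_mem_closedBall (Metric.mem_closedBall_self b.rIn_pos.le)
    simp [f, hl, this]

/-- One finite index set serves a whole neighbourhood, so locally finite sums may be treated there
as finite ones. -/
theorem exists_finset_eventually {α : Type*} {f : α → X → ℝ}
    (hf : LocallyFinite fun a ↦ Function.support (f a)) (x : X) :
    ∃ I : Finset α, ∀ᶠ y in 𝓝 x, ∀ a ∉ I, f a y = 0 := by
  obtain ⟨M, hM, hfin⟩ := hf x
  refine ⟨hfin.toFinset, Filter.mem_of_superset hM fun y hy a ha ↦ by_contra fun h ↦ ha ?_⟩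
  exact hfin.mem_toFinset.2 ⟨y, h, hy⟩

/-- Smooth partitions of unity on `X`. -/
theorem AnalyticVariety.exists_partition {L : Type*} {X : Type u} [TopologicalSpace X]
    (V : AnalyticVariety L X) {ι : Type*} (N : ι → Set X)
    (hN : ∀ i, IsOpen (N i)) (hcov : ∀ x, ∃ i, x ∈ N i) :
    ∃ (α : Type u) (i : α → ι) (ρ : α → X → ℝ), (∀ a, IsSmooth V (ρ a)) ∧
      LocallyFinite (fun a ↦ Function.support (ρ a)) ∧ (∀ a, tsupport (ρ a) ⊆ N (i a)) ∧
      ∀ x, ∑ᶠ a, ρ a x = 1 := by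
  have := V.t2Space
  have := V.secondCountable
  have := V.weaklyLocallyCompactSpace
  have : LocallyCompactSpace X := inferInstance
  choose i hi using hcov
  -- The supports of bump functions form a neighbourhood basis, so the refinement theorem returns a
  -- locally finite covering by such supports. Its index type lives in the universe of `X`.
  have hB : ∀ x, (𝓝 x).HasBasis
      (fun f : X → ℝ ↦ IsSmooth V f ∧ (∀ y, 0 ≤ f y) ∧ f x ≠ 0 ∧ tsupport f ⊆ N (i x))
      (fun f ↦ Function.support f) := by
    refine fun x ↦ ⟨fun t ↦ ⟨fun ht ↦ ?_, ?_⟩⟩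
    · obtain ⟨f, h1, h2, h3, h4⟩ :=
        V.exists_bump (Filter.inter_mem ht ((hN (i x)).mem_nhds (hi x)))
      exact ⟨f, ⟨h1, h2, h3, h4.trans inter_subset_right⟩,
        (subset_tsupport f).trans (h4.trans inter_subset_left)⟩
    · rintro ⟨f, ⟨h1, -, h3, -⟩, hft⟩
      exact Filter.mem_of_superset (h1.continuous.isOpen_support.mem_nhds h3) hft
  obtain ⟨α, c, f, hf, hfcov, hfin⟩ := refinement_of_locallyCompact_sigmaCompact_of_nhds_basis hB
  have hfinx : ∀ x, (Function.support fun a ↦ f a x).Finite := fun x ↦ hfin.point_finite x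
  -- The normalizing factor: it is positive because the supports cover `X` and the summands are
  -- nonnegative.
  let s : X → ℝ := fun x ↦ ∑ᶠ a, f a x
  have hs : ∀ x, s x ≠ 0 := by
    intro x
    obtain ⟨a, ha⟩ := mem_iUnion.1 (hfcov.symm ▸ mem_univ x)
    exact (finsum_pos (fun b ↦ (hf b).2.1 x) ⟨a, ((hf a).2.1 x).lt_of_ne' ha⟩ (hfinx x)).ne'
  have hs' : IsSmooth V s := by
    intro x l hl
    obtain ⟨I, hI⟩ := exists_finset_eventually hfin x
    refine (SmoothAt.sum I fun a ↦ (hf a).1 x l hl).congr ?_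
    filter_upwards [hI] with y hy
    exact finsum_eq_sum_of_support_subset _ fun a ha ↦ by_contra fun h ↦ ha (hy a h)
  refine ⟨α, fun a ↦ i (c a), fun a y ↦ f a y * (s y)⁻¹, fun a x l hl ↦
    ((hf a).1 x l hl).mul ((hs' x l hl).inv (hs x)), hfin.subset fun a y hy ↦
      left_ne_zero_of_mul hy, fun a ↦ ?_, fun x ↦ ?_⟩
  · exact (closure_mono fun y hy ↦ left_ne_zero_of_mul hy).trans (hf a).2.2.2
  · rw [← finsum_mul]
    exact mul_inv_cancel₀ (hs x)

end Smooth

section Extension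

variable {L X : Type*} [TopologicalSpace X] {V : AnalyticVariety L X}

/-! ### Gluing extendable forms -/

section Glue

variable {𝕜 : Type*} [RCLike 𝕜] {S T : Set X} {p : ℕ}

theorem coordRep_of_mem (θ : Family V 𝕜 S p) (ψ : RegularParam V) {u : Fin ψ.dim → ℂ}
    (hu : u ∈ ψ.dom S) : coordRep θ ψ u = θ.coord ψ ⟨u, hu⟩ :=
  dif_pos hu

/-- Stated separately because the instances on covectors do not unify by `rw`. -/
theorem covector_zero_smul {n : ℕ} (v : (Fin n → ℂ) [⋀^Fin p]→L[ℝ] 𝕜) : (0 : ℝ) • v = 0 :=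
  zero_smul ℝ v

/-- A weighted sum whose terms agree where the weights do not vanish. -/
theorem finsum_smul_eq {α : Type*} {n : ℕ} {ρ : α → ℝ} (h1 : ∑ᶠ a, ρ a = 1)
    {w : α → (Fin n → ℂ) [⋀^Fin p]→L[ℝ] 𝕜} {v : (Fin n → ℂ) [⋀^Fin p]→L[ℝ] 𝕜}
    (h : ∀ a, ρ a ≠ 0 → w a = v) : ∑ᶠ a, ρ a • w a = v := by
  have : ∀ a, ρ a • w a = ρ a • v := fun a ↦ by
    by_cases ha : ρ a = 0
    · rw [ha, covector_zero_smul, covector_zero_smul]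
    · rw [h a ha]
  rw [finsum_congr this]
  refine (finsum_smul ρ v).symm.trans ?_
  rw [h1]
  exact one_smul ℝ v

/-- Being an extendable form is a local property. -/
theorem mem_extForms_of_locally (θ : Family V 𝕜 T p)
    (h : ∀ x ∈ T, ∃ θ' ∈ extForms V 𝕜 T p, ∀ᶠ y in 𝓝 x, ∀ (ψ : RegularParam V) (u : ψ.dom T),
      ψ.toFun u = y → θ.coord ψ u = θ'.coord ψ u) : θ ∈ extForms V 𝕜 T p := by
  refine ⟨fun ψ φ u v huv ↦ ?_, fun x hx ↦ ?_⟩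
  · obtain ⟨θ', hθ', he⟩ := h _ u.2.2
    rw [he.self_of_nhds ψ u rfl, he.self_of_nhds φ v huv.symm]
    exact hθ'.1 ψ φ u v huv
  · obtain ⟨θ', hθ', he⟩ := h x hx
    obtain ⟨l, O, η, hl, hO, hη⟩ := hθ'.2 x hx
    obtain ⟨Q, hQ, hxQ, -, hQe⟩ := V.exists_isOpen_of_eventually hl he
    refine ⟨l, O ∩ Q, η, hl, ⟨hO, hxQ⟩, hη.1.inter hQ, fun z hz ↦ hη.2.1 hz.1,
      hη.2.2.1.mono inter_subset_left, fun ψ u hul huO ↦ ?_⟩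
    rw [hQe _ hul huO.2 ψ u rfl]
    exact hη.2.2.2 ψ u hul huO.1

/-- The product of the smooth function `ρ` with the form `θ` over `S`, extended by zero. -/
def smulExt (ρ : X → ℝ) (hρ : IsSmooth V ρ) (h : T ∩ tsupport ρ ⊆ S) (θ : extForms V 𝕜 S p) :
    extForms V 𝕜 T p :=
  ⟨⟨fun ψ u ↦ ρ (ψ.toFun u) • coordRep θ.1 ψ u⟩, by
    refine ⟨fun ψ φ u v huv ↦ ?_, fun x hx ↦ ?_⟩
    · change ρ (ψ.toFun u) • coordRep θ.1 ψ u =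
        (ρ (φ.toFun v) • coordRep θ.1 φ v).compContinuousLinearMap _
      by_cases hu : ψ.toFun u ∈ S
      · have hv : φ.toFun v ∈ S := huv ▸ hu
        rw [coordRep_of_mem _ _ ⟨u.2.1, hu⟩, coordRep_of_mem _ _ ⟨v.2.1, hv⟩,
          θ.2.1 ψ φ ⟨u, u.2.1, hu⟩ ⟨v, v.2.1, hv⟩ huv, congrArg ρ huv]
        rfl
      -- The point lies in `T` but not in `S`, so `h` places it outside the support of `ρ`.
      · have h0 : ρ (ψ.toFun u) = 0 := by
          by_contra h0
          exact hu (h ⟨u.2.2, subset_tsupport _ h0⟩)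
        rw [← huv, h0, covector_zero_smul, covector_zero_smul]
        rfl
    -- On the support, a local extension is the product of ambient extensions of `ρ` and `θ`. Off
    -- the support the product vanishes near `x`, and the zero form extends it.
    · by_cases hxρ : x ∈ tsupport ρ
      · obtain ⟨l, O, η, hl, hO, hη⟩ := θ.2.2 x (h ⟨hx, hxρ⟩)
        obtain ⟨g, hg, hρg⟩ := hρ x l hl
        obtain ⟨Q, hQ, hxQ, hQU, hQe⟩ := V.exists_isOpen_of_eventually hl hρg
        obtain ⟨N, hNg, hN, hxN⟩ := eventually_nhds_iff.1 hg
        refine ⟨l, O ∩ (Q ∩ N), fun z ↦ g z • η z, hl, ⟨hO, hxQ, hxN⟩,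
          hη.1.inter (hQ.inter hN), fun z hz ↦ hη.2.1 hz.1, ?_, fun ψ u hul huO ↦ ?_⟩
        · exact ContDiffOn.smul (fun z hz ↦ (hNg z hz.2.2).contDiffWithinAt)
            (hη.2.2.1.mono inter_subset_left)
        · change ρ (ψ.toFun u) • coordRep θ.1 ψ u = _
          have hg' := hQe _ hul huO.2.1
          by_cases hu : ψ.toFun u ∈ S
          · rw [coordRep_of_mem _ _ ⟨u.2.1, hu⟩, hη.2.2.2 ψ ⟨u, u.2.1, hu⟩ hul huO.1, hg']
            rfl
          -- Off `S` the form `η` is not tied to `θ`, but the ambient function `g` takes the value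
          -- of `ρ` there, which is zero.
          · have h0 : ρ (ψ.toFun u) = 0 := by
              by_contra h0
              exact hu (h ⟨u.2.2, subset_tsupport _ h0⟩)
            unfold RegularParam.pullback
            beta_reduce
            rw [← hg', h0, covector_zero_smul, covector_zero_smul]
            rfl
      · obtain ⟨l, hl⟩ := V.exists_mem_A x
        obtain ⟨Q, hQ, hxQ, hQU, hQe⟩ := V.exists_isOpen_of_eventually hl
          (notMem_tsupport_iff_eventuallyEq.1 hxρ)
        refine ⟨l, Q, 0, hl, hxQ, hQ, hQU, contDiffOn_const, fun ψ u hul huO ↦ ?_⟩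
        change ρ (ψ.toFun u) • coordRep θ.1 ψ u = _
        rw [show ρ (ψ.toFun u) = 0 from hQe _ hul huO, covector_zero_smul]
        rfl⟩

theorem Family.sum_coord {α : Type*} (s : Finset α) (θ : α → Family V 𝕜 S p)
    (ψ : RegularParam V) (u : ψ.dom S) :
    (∑ a ∈ s, θ a).coord ψ u = ∑ a ∈ s, (θ a).coord ψ u :=
  map_sum (AddMonoidHom.mk' (fun θ : Family V 𝕜 S p ↦ θ.coord ψ u) fun _ _ ↦ rfl) θ s

/-- The locally finite sum of the products of smooth functions `ρ a` with forms `θ a` defined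
around the supports of the `ρ a`. -/
def glue {α : Type*} (ρ : α → X → ℝ) (hρ : ∀ a, IsSmooth V (ρ a))
    (hfin : LocallyFinite fun a ↦ Function.support (ρ a)) {S : α → Set X}
    (h : ∀ a, T ∩ tsupport (ρ a) ⊆ S a) (θ : ∀ a, extForms V 𝕜 (S a) p) : extForms V 𝕜 T p :=
  ⟨⟨fun ψ u ↦ ∑ᶠ a, ρ a (ψ.toFun u) • coordRep (θ a).1 ψ u⟩, by
    refine mem_extForms_of_locally _ fun x hx ↦ ?_
    obtain ⟨I, hI⟩ := exists_finset_eventually hfin x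
    -- Near `x` only the indices in `I` contribute, so the infinite sum agrees there with a finite
    -- sum of extendable forms.
    refine ⟨(∑ a ∈ I, smulExt (ρ a) (hρ a) (h a) (θ a)).1, Subtype.property _, ?_⟩
    filter_upwards [hI] with y hy ψ u huy
    rw [AddSubmonoidClass.coe_finsetSum, Family.sum_coord]
    refine finsum_eq_sum_of_support_subset _ fun a ha ↦ by_contra fun haI ↦ ha ?_
    beta_reduce
    rw [huy, hy a haI, covector_zero_smul]⟩

theorem glue_coord {α : Type*} (ρ : α → X → ℝ) (hρ : ∀ a, IsSmooth V (ρ a))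
    (hfin : LocallyFinite fun a ↦ Function.support (ρ a)) {S : α → Set X}
    (h : ∀ a, T ∩ tsupport (ρ a) ⊆ S a) (θ : ∀ a, extForms V 𝕜 (S a) p)
    (ψ : RegularParam V) (u : ψ.dom T) :
    (glue ρ hρ hfin h θ).1.coord ψ u = ∑ᶠ a, ρ a (ψ.toFun u) • coordRep (θ a).1 ψ u := rfl

end Glue

/-! ### Extension of forms from a closed set -/

/-- Pulling back a local extension along its chart defines a form on a full open neighbourhood in
`X`. A partition of unity glues these forms; on `Z` all the terms with nonzero weight equal `θ`, so
their weighted sum is `θ`. -/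
theorem exists_extension {L : Type*} {X : Type u} [TopologicalSpace X]
    {V : AnalyticVariety L X} {𝕜 : Type*} [RCLike 𝕜] {Z : Set X} {p : ℕ} (hZ : IsClosed Z)
    (θ : extForms V 𝕜 Z p) : ∃ κ : extForms V 𝕜 univ p, res (subset_univ Z) κ = θ := by
  have key : ∀ x, ∃ N : Set X, IsOpen N ∧ x ∈ N ∧ ∃ θ' : extForms V 𝕜 N p,
      ∀ (ψ : RegularParam V) (u : ψ.dom Z) (hu : ψ.toFun u ∈ N),
        θ'.1.coord ψ ⟨u, u.2.1, hu⟩ = θ.1.coord ψ u := by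
    intro x
    by_cases hx : x ∈ Z
    · obtain ⟨l, O, η, hl, hO, hη⟩ := θ.2.2 x hx
      refine ⟨V.A l ∩ V.F l ⁻¹' O, ?_, ⟨hl, hO⟩, ⟨⟨fun ψ u ↦ ψ.pullback l η u⟩,
        fun ψ φ u v huv ↦ ψ.pullback_change φ u.2.1 v.2.1 huv u.2.2.1 η,
        fun y hy ↦ ⟨l, O, η, hy.1, hy.2, hη.1, hη.2.1, hη.2.2.1, fun ψ u _ _ ↦ rfl⟩⟩,
        fun ψ u hu ↦ (hη.2.2.2 ψ u hu.1 hu.2).symm⟩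
      exact (continuousOn_iff_continuous_domRestrict.2
        (V.isEmbedding_F l).continuous).isOpen_inter_preimage (V.isOpen_A l) hη.1
    -- Away from `Z` there is nothing to match, so the zero form will do; this is where closedness
    -- of `Z` enters.
    · exact ⟨Zᶜ, hZ.isOpen_compl, hx, 0, fun ψ u hu ↦ absurd u.2.2 hu⟩
  choose N hN hxN θ' hθ' using key
  obtain ⟨α, i, ρ, hρ, hfin, hsupp, hsum⟩ := V.exists_partition N hN fun x ↦ ⟨x, hxN x⟩
  refine ⟨glue ρ hρ hfin (fun a ↦ inter_subset_right.trans (hsupp a)) fun a ↦ θ' (i a), ?_⟩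
  refine Subtype.ext (Family.ext (funext fun ψ ↦ funext fun u ↦ ?_))
  change ∑ᶠ a, ρ a (ψ.toFun u) • coordRep (θ' (i a)).1 ψ u = _
  refine finsum_smul_eq (hsum _) fun a ha ↦ ?_
  have hu : ψ.toFun u ∈ N (i a) := hsupp a (subset_tsupport _ ha)
  rw [coordRep_of_mem _ _ ⟨u.2.1, hu⟩, hθ' (i a) ψ u hu]

/-! ### Exactness of the rows of the Čech–de Rham complex -/

section Rows

variable {L : Type*} {X : Type u} [TopologicalSpace X] {V : AnalyticVariety L X}
  {𝕜 : Type*} [RCLike 𝕜] {J : Type*} {Z : Set X} {p q : ℕ} {𝒱 : J → TopologicalSpace.Opens X}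

theorem mem_vanishingForms_iff {S : Set X} {θ : extForms V 𝕜 S p} :
    θ ∈ vanishingForms V 𝕜 S Z p ↔
      ∀ (ψ : RegularParam V) (u : ψ.dom S), ψ.toFun u ∈ Z → θ.1.coord ψ u = 0 := by
  constructor
  · intro h ψ u hu
    have h' : res (inter_subset_left : S ∩ Z ⊆ S) θ = 0 := h
    exact congrArg (fun σ : extForms V 𝕜 (S ∩ Z) p ↦ σ.1.coord ψ ⟨u, u.2.1, u.2.2, hu⟩) h'
  · intro h
    exact Subtype.ext (Family.ext (funext fun ψ ↦ funext fun u ↦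
      h ψ ⟨u, u.2.1, u.2.2.1⟩ u.2.2.2))

theorem coordRep_of_vanishing {S : Set X} (θ : vanishingForms V 𝕜 S Z p) (ψ : RegularParam V)
    {u : Fin ψ.dim → ℂ} (hu : ψ.toFun u ∈ Z) : coordRep θ.1.1 ψ u = 0 := by
  by_cases h : u ∈ ψ.dom S
  · rw [coordRep_of_mem _ _ h]
    exact mem_vanishingForms_iff.1 θ.2 ψ ⟨u, h⟩ hu
  · exact dif_neg h

/-- `glue` for forms vanishing on `Z`. -/
def vanishingGlue {T : Set X} {α : Type*} (ρ : α → X → ℝ) (hρ : ∀ a, IsSmooth V (ρ a))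
    (hfin : LocallyFinite fun a ↦ Function.support (ρ a)) {S : α → Set X}
    (h : ∀ a, T ∩ tsupport (ρ a) ⊆ S a) (θ : ∀ a, vanishingForms V 𝕜 (S a) Z p) :
    vanishingForms V 𝕜 T Z p :=
  ⟨glue ρ hρ hfin h fun a ↦ (θ a).1, mem_vanishingForms_iff.2 fun ψ u hu ↦ by
    rw [glue_coord]
    refine (finsum_congr fun a ↦ ?_).trans finsum_zero
    rw [coordRep_of_vanishing _ _ hu]
    exact smul_zero (A := (Fin ψ.dim → ℂ) [⋀^Fin p]→L[ℝ] 𝕜) (ρ a (ψ.toFun u))⟩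

/-- The terms live over different open sets. Expressing them through `coordRep` drops the
restrictions and puts all of them into one space of covectors. -/
theorem coordRep_cechδ (σ : CechForms V 𝕜 𝒱 Z p q) (j : Fin (q + 2) → J)
    (ψ : RegularParam V) (u : ψ.dom (cechInter 𝒱 j)) :
    (cechδ 𝒱 Z p q σ j).1.1.coord ψ u =
      ∑ m : Fin (q + 2), (-1 : 𝕜) ^ (m : ℕ) • coordRep (σ (j ∘ m.succAbove)).1.1 ψ u := by
  have hm : ∀ m : Fin (q + 2), coordRep (σ (j ∘ m.succAbove)).1.1 ψ u =
      (σ (j ∘ m.succAbove)).1.1.coord ψ ⟨u, u.2.1, cechInter_subset 𝒱 j m u.2.2⟩ := fun m ↦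
    coordRep_of_mem _ _ _
  simp only [hm]
  have hs : cechδ 𝒱 Z p q σ j = ∑ m : Fin (q + 2), (-1 : 𝕜) ^ (m : ℕ) •
      vanishingRes (cechInter_subset 𝒱 j m) (σ (j ∘ m.succAbove)) := by
    simp [cechδ]
  rw [hs, AddSubmonoidClass.coe_finsetSum, AddSubmonoidClass.coe_finsetSum, Family.sum_coord]
  rfl

theorem cechInter_cons {j₀ : J} {j : Fin (q + 1) → J} {x : X} (h₀ : x ∈ 𝒱 j₀)
    (h : x ∈ cechInter 𝒱 j) : x ∈ cechInter 𝒱 (Fin.cons j₀ j : Fin (q + 2) → J) :=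
  mem_iInter.2 fun m ↦ by
    induction m using Fin.cases with
    | zero => exact h₀
    | succ m => exact mem_iInter.1 h m

/-- Forms on the members of `𝒱` which agree on the intersections come from a global form. -/
theorem exists_cechRes_eq (h𝒱 : (⋃ j, (𝒱 j : Set X)) = univ) (σ : CechForms V 𝕜 𝒱 Z p 0)
    (hσ : cechδ 𝒱 Z p 0 σ = 0) : ∃ θ : vanishingForms V 𝕜 univ Z p, cechRes 𝒱 Z p θ = σ := by
  obtain ⟨α, i, ρ, hρ, hfin, hsupp, hsum⟩ := V.exists_partition (fun j ↦ (𝒱 j : Set X))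
    (fun j ↦ (𝒱 j).isOpen) fun x ↦ mem_iUnion.1 (h𝒱.symm ▸ mem_univ x)
  have hS : ∀ a, univ ∩ tsupport (ρ a) ⊆ cechInter 𝒱 (fun _ : Fin (0 + 1) ↦ i a) := fun a ↦
    inter_subset_right.trans ((hsupp a).trans (subset_iInter fun _ ↦ Subset.rfl))
  refine ⟨vanishingGlue ρ hρ hfin hS fun a ↦ σ fun _ ↦ i a, funext fun j ↦ ?_⟩
  refine Subtype.ext (Subtype.ext (Family.ext (funext fun ψ ↦ funext fun u ↦ ?_)))
  change ∑ᶠ a, ρ a (ψ.toFun u) • coordRep (σ fun _ ↦ i a).1.1 ψ u = _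
  refine finsum_smul_eq (hsum _) fun a ha ↦ ?_
  -- Where `ρ a` does not vanish the point lies in `𝒱 (i a)`, and the cocycle condition on the pair
  -- `(i a, j)` identifies the two forms there.
  have hu : ψ.toFun u ∈ cechInter 𝒱 (Fin.cons (i a) j : Fin (0 + 2) → J) :=
    cechInter_cons (hsupp a (subset_tsupport _ ha)) u.2.2
  have h0 := coordRep_cechδ σ (Fin.cons (i a) j) ψ ⟨u, u.2.1, hu⟩
  rw [hσ, Fin.sum_univ_two] at h0
  have e0 : (Fin.cons (i a) j : Fin (0 + 2) → J) ∘ (0 : Fin 2).succAbove = j := rfl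
  have e1 : (Fin.cons (i a) j : Fin (0 + 2) → J) ∘ (1 : Fin 2).succAbove = fun _ ↦ i a := by
    funext k
    rw [Subsingleton.elim k 0]
    rfl
  rw [e0, e1, coordRep_of_mem (σ j).1.1 _ u.2] at h0
  simp only [Fin.val_zero, Fin.val_one, pow_zero, pow_one, one_smul] at h0
  rw [neg_one_smul 𝕜 (coordRep (σ fun _ ↦ i a).1.1 ψ u)] at h0
  exact (sub_eq_zero.1 ((sub_eq_add_neg _ _).trans h0.symm)).symm

/-- The rows of the Čech–de Rham complex are exact in positive degrees. -/
theorem exists_cechδ_eq (h𝒱 : (⋃ j, (𝒱 j : Set X)) = univ) (σ : CechForms V 𝕜 𝒱 Z p (q + 1))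
    (hσ : cechδ 𝒱 Z p (q + 1) σ = 0) : ∃ τ : CechForms V 𝕜 𝒱 Z p q, cechδ 𝒱 Z p q τ = σ := by
  obtain ⟨α, i, ρ, hρ, hfin, hsupp, hsum⟩ := V.exists_partition (fun j ↦ (𝒱 j : Set X))
    (fun j ↦ (𝒱 j).isOpen) fun x ↦ mem_iUnion.1 (h𝒱.symm ▸ mem_univ x)
  have hS : ∀ (j : Fin (q + 1) → J) a, cechInter 𝒱 j ∩ tsupport (ρ a) ⊆
      cechInter 𝒱 (Fin.cons (i a) j : Fin (q + 2) → J) := fun j a x hx ↦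
    cechInter_cons (hsupp a hx.2) hx.1
  -- The classical contracting homotopy `τ_j = ∑ ρ_a σ_(i(a), j)`; each term extends by zero because
  -- `ρ a` is supported in `𝒱 (i a)`.
  refine ⟨fun j ↦ vanishingGlue ρ hρ hfin (hS j) fun a ↦ σ (Fin.cons (i a) j),
    funext fun j ↦ ?_⟩
  refine Subtype.ext (Subtype.ext (Family.ext (funext fun ψ ↦ funext fun u ↦ ?_)))
  rw [coordRep_cechδ]
  have hm : ∀ m : Fin (q + 2), coordRep (vanishingGlue ρ hρ hfin (hS (j ∘ m.succAbove))
      fun a ↦ σ (Fin.cons (i a) (j ∘ m.succAbove))).1.1 ψ u =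
        ∑ᶠ a, ρ a (ψ.toFun u) • coordRep (σ (Fin.cons (i a) (j ∘ m.succAbove))).1.1 ψ u :=
    fun m ↦ coordRep_of_mem _ _ ⟨u.2.1, cechInter_subset 𝒱 j m u.2.2⟩
  have hfinu : (Function.support fun a ↦ ρ a (ψ.toFun u)).Finite := hfin.point_finite _
  have hsub : ∀ m : Fin (q + 2), (Function.support fun a ↦ (-1 : 𝕜) ^ (m : ℕ) •
      ρ a (ψ.toFun u) • coordRep (σ (Fin.cons (i a) (j ∘ m.succAbove))).1.1 ψ u).Finite :=
    fun m ↦ hfinu.subset fun a ha h0 ↦ ha (by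
      beta_reduce
      rw [show ρ a (ψ.toFun u) = 0 from h0, covector_zero_smul]
      exact smul_zero (M := 𝕜) (A := (Fin ψ.dim → ℂ) [⋀^Fin p]→L[ℝ] 𝕜) _)
  simp only [hm, smul_finsum]
  rw [← finsum_sum_comm _ _ fun m _ ↦ hsub m]
  have hcomm : ∀ a, (∑ m : Fin (q + 2), (-1 : 𝕜) ^ (m : ℕ) •
      ρ a (ψ.toFun u) • coordRep (σ (Fin.cons (i a) (j ∘ m.succAbove))).1.1 ψ u) =
        ρ a (ψ.toFun u) • ∑ m : Fin (q + 2), (-1 : 𝕜) ^ (m : ℕ) •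
          coordRep (σ (Fin.cons (i a) (j ∘ m.succAbove))).1.1 ψ u := fun a ↦ by
    rw [Finset.smul_sum]
    exact Finset.sum_congr rfl fun m _ ↦ smul_comm _ _ _
  rw [finsum_congr hcomm]
  refine finsum_smul_eq (hsum _) fun a ha ↦ ?_
  -- The cocycle condition on the tuple `(i a, j)` is solved for the face omitting `i a`: that face
  -- is `σ j`, and the others, whose signs shift by one, add up to the inner sum.
  have hu : ψ.toFun u ∈ cechInter 𝒱 (Fin.cons (i a) j : Fin (q + 1 + 2) → J) :=
    cechInter_cons (hsupp a (subset_tsupport _ ha)) u.2.2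
  have h0 := coordRep_cechδ σ (Fin.cons (i a) j) ψ ⟨u, u.2.1, hu⟩
  rw [hσ, Fin.sum_univ_succ] at h0
  have e0 : (Fin.cons (i a) j : Fin (q + 1 + 2) → J) ∘ (0 : Fin (q + 1 + 2)).succAbove = j := by
    funext k
    simp
  have e1 : ∀ m : Fin (q + 2), (Fin.cons (i a) j : Fin (q + 1 + 2) → J) ∘ m.succ.succAbove =
      Fin.cons (i a) (j ∘ m.succAbove) := fun m ↦ by
    funext k
    induction k using Fin.cases <;> simp
  have e2 : ∀ m : Fin (q + 2), (-1 : 𝕜) ^ (m.succ : ℕ) •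
      coordRep (σ ((Fin.cons (i a) j : Fin (q + 1 + 2) → J) ∘ m.succ.succAbove)).1.1 ψ u =
        -((-1 : 𝕜) ^ (m : ℕ) •
          coordRep (σ (Fin.cons (i a) (j ∘ m.succAbove))).1.1 ψ u) := fun m ↦ by
    rw [e1, Fin.val_succ, pow_succ, mul_neg_one]
    exact neg_smul (M := (Fin ψ.dim → ℂ) [⋀^Fin p]→L[ℝ] 𝕜) _ _
  rw [e0, coordRep_of_mem (σ j).1.1 _ u.2, Finset.sum_congr rfl fun m _ ↦ e2 m,
    Finset.sum_neg_distrib, Fin.val_zero, pow_zero, one_smul] at h0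
  exact (sub_eq_zero.1 ((sub_eq_add_neg _ _).trans h0.symm)).symm

end Rows

end Extension

section Comparison

variable {L : Type*} {X : Type u} [TopologicalSpace X] {V : AnalyticVariety L X}
  {𝕜 : Type*} [RCLike 𝕜] {J : Type*} {Z : Set X}

/-! ### Bijectivity criteria for maps in cohomology -/

section Cohomology

variable {R : Type*} [Ring R] {M N : ℕ → Type*}
  [∀ r, AddCommGroup (M r)] [∀ r, Module R (M r)] [∀ r, AddCommGroup (N r)] [∀ r, Module R (N r)]
  {dM : (r : ℕ) → M r →ₗ[R] M (r + 1)} {dN : (r : ℕ) → N r →ₗ[R] N (r + 1)}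

theorem Cohomology.map_injective {f : (r : ℕ) → M r →ₗ[R] N r}
    (hf : ∀ r x, f (r + 1) (dM r x) = dN r (f r x)) (r : ℕ)
    (h : ∀ x, dM r x = 0 → f r x ∈ coboundaries dN r → x ∈ coboundaries dM r) :
    Function.Injective (Cohomology.map f hf r) := by
  refine (injective_iff_map_eq_zero _).2 fun c ↦ ?_
  obtain ⟨⟨x, hx⟩, rfl⟩ := Submodule.Quotient.mk_surjective _ c
  intro hc
  exact (Submodule.Quotient.mk_eq_zero _).2 (h x hx ((Submodule.Quotient.mk_eq_zero
    ((coboundaries dN r).submoduleOf (cocycles dN r))).1 hc))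

theorem Cohomology.map_surjective {f : (r : ℕ) → M r →ₗ[R] N r}
    (hf : ∀ r x, f (r + 1) (dM r x) = dN r (f r x)) (r : ℕ)
    (h : ∀ y, dN r y = 0 → ∃ x, dM r x = 0 ∧ f r x - y ∈ coboundaries dN r) :
    Function.Surjective (Cohomology.map f hf r) := by
  intro c
  obtain ⟨⟨y, hy⟩, rfl⟩ := Submodule.Quotient.mk_surjective _ c
  obtain ⟨x, hx, hxy⟩ := h y hy
  exact ⟨Submodule.Quotient.mk ⟨x, hx⟩, (Submodule.Quotient.eq _).2 hxy⟩

end Cohomology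

/-! ### Comparison with the pair `(X, Z)` -/

theorem IsEmptyOrClosureOfOpen.isClosed (hZ : IsEmptyOrClosureOfOpen Z) : IsClosed Z := by
  rcases hZ with rfl | ⟨O, -, -, rfl⟩
  · exact isClosed_empty
  · exact isClosed_closure

/-- Vanishing is defined by restriction to `univ ∩ Z`, whereas the pair complex restricts to `Z`.
These sets are equal but not definitionally, so each direction restricts along an inclusion. -/
theorem mem_vanishingForms_univ_iff {p : ℕ} {θ : extForms V 𝕜 univ p} :
    θ ∈ vanishingForms V 𝕜 univ Z p ↔ res (subset_univ Z) θ = 0 := by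
  constructor
  · intro h
    have h' : res (inter_subset_left : univ ∩ Z ⊆ univ) θ = 0 := h
    exact (congrArg (res (subset_inter (subset_univ Z) Subset.rfl)) h').trans (map_zero _)
  · intro h
    exact (congrArg (res (inter_subset_right : univ ∩ Z ⊆ Z)) h).trans (map_zero _)

/-- Restriction commutes with the differential, so `κ - dκ'` restricts to `dυ - dυ = 0` for any
extension `κ'` of `υ`. -/
theorem exists_extension_prev (hZ : IsEmptyOrClosureOfOpen Z) (p : ℕ)
    (υ : extForms V 𝕜 Z p) (κ : extForms V 𝕜 univ (p + 1))
    (h : res (subset_univ Z) κ = d hZ.subset p υ) :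
    ∃ κ' : extForms V 𝕜 univ p, res (subset_univ Z) κ' = υ ∧
      κ - d (subset_of_isOpen isOpen_univ) p κ' ∈ vanishingForms V 𝕜 univ Z (p + 1) := by
  obtain ⟨κ', hκ'⟩ := exists_extension hZ.isClosed υ
  refine ⟨κ', hκ', mem_vanishingForms_univ_iff.2 ?_⟩
  rw [map_sub, h, ← d_res hZ.subset, hκ', sub_self]

/-- If `(θ, 0)` is the differential of `(κ, υ)`, then `κ - dκ'` is a primitive of `θ` that vanishes
on `Z`. In degree one `υ` is trivial, and `κ` itself vanishes on `Z`. -/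
theorem toPairCohomology_injective (hZ : IsEmptyOrClosureOfOpen Z) (r : ℕ) :
    Function.Injective (toPairCohomology V 𝕜 hZ r) := by
  refine Cohomology.map_injective _ r fun θ hθ h ↦ ?_
  match r, θ, h with
  | 0, θ, h =>
    have h' : toPair V 𝕜 Z 0 θ = 0 := h
    exact Subtype.ext (congrArg Prod.fst h')
  | 1, θ, ⟨⟨κ, υ⟩, h⟩ =>
    have h1 : d (subset_of_isOpen isOpen_univ) 0 κ = θ.1 := congrArg Prod.fst h
    have h2 : res (subset_univ Z) κ - 0 = 0 := congrArg Prod.snd h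
    exact ⟨⟨κ, mem_vanishingForms_univ_iff.2 (by rwa [sub_zero] at h2)⟩, Subtype.ext h1⟩
  | p + 2, θ, ⟨⟨κ, υ⟩, h⟩ =>
    have h1 : d (subset_of_isOpen isOpen_univ) (p + 1) κ = θ.1 := congrArg Prod.fst h
    have h2 : res (subset_univ Z) κ - d hZ.subset p υ = 0 := congrArg Prod.snd h
    obtain ⟨κ', -, hκ'⟩ := exists_extension_prev hZ p υ κ (sub_eq_zero.1 h2)
    refine ⟨⟨_, hκ'⟩, Subtype.ext ?_⟩
    change d (subset_of_isOpen isOpen_univ) (p + 1) (κ - d (subset_of_isOpen isOpen_univ) p κ') = _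
    rw [map_sub, d_d, sub_zero, h1]

theorem toPairCohomology_surjective (hZ : IsEmptyOrClosureOfOpen Z) (r : ℕ) :
    Function.Surjective (toPairCohomology V 𝕜 hZ r) := by
  refine Cohomology.map_surjective _ r fun y hy ↦ ?_
  match r, y, hy with
  | 0, ⟨κ, υ⟩, h =>
    have h1 : d (subset_of_isOpen isOpen_univ) 0 κ = 0 := congrArg Prod.fst h
    have h2 : res (subset_univ Z) κ - 0 = 0 := congrArg Prod.snd h
    refine ⟨⟨κ, mem_vanishingForms_univ_iff.2 (by rwa [sub_zero] at h2)⟩, Subtype.ext h1, ?_⟩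
    change _ - _ = (0 : PairForms V 𝕜 Z 0)
    exact Prod.ext (sub_self κ) rfl
  | p + 1, ⟨κ, υ⟩, h =>
    have h1 : d (subset_of_isOpen isOpen_univ) (p + 1) κ = 0 := congrArg Prod.fst h
    have h2 : res (subset_univ Z) κ - d hZ.subset p υ = 0 := congrArg Prod.snd h
    obtain ⟨κ', hκ', hv⟩ := exists_extension_prev hZ p υ κ (sub_eq_zero.1 h2)
    -- The differential of `(-κ', 0)` is `(-dκ', -υ)`, exactly the difference between `(κ - dκ', 0)`
    -- and `(κ, υ)`.
    refine ⟨⟨_, hv⟩, Subtype.ext ?_, (-κ', 0), Prod.ext ?_ ?_⟩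
    · change d (subset_of_isOpen isOpen_univ) (p + 1)
        (κ - d (subset_of_isOpen isOpen_univ) p κ') = 0
      rw [map_sub, d_d, sub_zero, h1]
    · change d (subset_of_isOpen isOpen_univ) p (-κ') =
        (κ - d (subset_of_isOpen isOpen_univ) p κ') - κ
      rw [map_neg]
      abel
    · let υ' : extForms V 𝕜 Z p := υ
      have hυ : res (subset_univ Z) (-κ') = -υ' := by rw [map_neg, hκ']
      change res (subset_univ Z) (-κ') - PrevForms.d hZ p 0 = 0 - υ'
      rw [map_zero, hυ, sub_zero, zero_sub]

/-! ### Comparison with the Čech–de Rham complex -/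

section Cech

variable {𝒱 : J → TopologicalSpace.Opens X}

theorem cechRes_injective (h𝒱 : (⋃ j, (𝒱 j : Set X)) = univ) (p : ℕ) :
    Function.Injective (cechRes (V := V) (𝕜 := 𝕜) 𝒱 Z p) := by
  refine fun θ θ' h ↦ Subtype.ext (Subtype.ext (Family.ext (funext fun ψ ↦ funext fun u ↦ ?_)))
  obtain ⟨j, hj⟩ := mem_iUnion.1 (h𝒱.ge (mem_univ (ψ.toFun u)))
  have hu : ψ.toFun u ∈ cechInter 𝒱 (fun _ : Fin (0 + 1) ↦ j) := mem_iInter.2 fun _ ↦ hj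
  exact congrArg (fun σ : CechForms V 𝕜 𝒱 Z p 0 ↦
    (σ fun _ ↦ j).1.1.coord ψ ⟨u, u.2.1, hu⟩) h

/-! ### Identities in the double complex -/

theorem vanishingD_vanishingD {S : Set X} (hS : IsOpen S) (hZ : IsEmptyOrClosureOfOpen Z) {p : ℕ}
    (θ : vanishingForms V 𝕜 S Z p) : vanishingD hS hZ (p + 1) (vanishingD hS hZ p θ) = 0 :=
  Subtype.ext (d_d (subset_of_isOpen hS) θ.1)

theorem cechd_cechd (hZ : IsEmptyOrClosureOfOpen Z) {p q : ℕ} (σ : CechForms V 𝕜 𝒱 Z p q) :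
    cechd 𝒱 hZ (p + 1) q (cechd 𝒱 hZ p q σ) = 0 :=
  funext fun j ↦ vanishingD_vanishingD (isOpen_cechInter 𝒱 j) hZ (σ j)

/-- The differential commutes with each restriction. The sign in `D = δ + (-1)^q d` turns this into
anticommutation. -/
theorem cechδ_cechd (hZ : IsEmptyOrClosureOfOpen Z) {p q : ℕ} (σ : CechForms V 𝕜 𝒱 Z p q) :
    cechδ 𝒱 Z (p + 1) q (cechd 𝒱 hZ p q σ) = cechd 𝒱 hZ p (q + 1) (cechδ 𝒱 Z p q σ) := by
  funext j
  have h1 : cechδ 𝒱 Z (p + 1) q (cechd 𝒱 hZ p q σ) j = ∑ m : Fin (q + 2), (-1 : 𝕜) ^ (m : ℕ) •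
      vanishingRes (cechInter_subset 𝒱 j m) (vanishingD (isOpen_cechInter 𝒱 _) hZ p
        (σ (j ∘ m.succAbove))) := by
    simp [cechδ, cechd]
  have h2 : cechd 𝒱 hZ p (q + 1) (cechδ 𝒱 Z p q σ) j = vanishingD (isOpen_cechInter 𝒱 j) hZ p
      (∑ m : Fin (q + 2), (-1 : 𝕜) ^ (m : ℕ) •
        vanishingRes (cechInter_subset 𝒱 j m) (σ (j ∘ m.succAbove))) := by
    simp [cechδ, cechd]
  rw [h1, h2, map_sum]
  refine Finset.sum_congr rfl fun m _ ↦ ?_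
  rw [map_smul]
  congr 1
  exact Subtype.ext (d_res (subset_of_isOpen (isOpen_cechInter 𝒱 j))
    (subset_of_isOpen (isOpen_cechInter 𝒱 _)) (cechInter_subset 𝒱 j m) (σ (j ∘ m.succAbove)).1).symm

theorem cechd_add_smul_cechd (hZ : IsEmptyOrClosureOfOpen Z) {p q : ℕ} {c : 𝕜}
    (σ : CechForms V 𝕜 𝒱 Z (p + 1) q) (τ : CechForms V 𝕜 𝒱 Z p q) :
    cechd 𝒱 hZ (p + 1) q (σ + c • cechd 𝒱 hZ p q τ) = cechd 𝒱 hZ (p + 1) q σ := by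
  rw [LinearMap.map_add, LinearMap.map_smul, cechd_cechd, smul_zero]
  exact add_zero _

theorem exists_cechTotal_single {p q r : ℕ} (h : p + q = r) (σ : CechForms V 𝕜 𝒱 Z p q) :
    ∃ z : CechTotal V 𝕜 𝒱 Z r, z ⟨(p, q), h⟩ = σ ∧ ∀ a, a ≠ ⟨(p, q), h⟩ → z a = 0 := by
  classical
  exact ⟨Pi.single (M := fun a : {a : ℕ × ℕ // a.1 + a.2 = r} ↦ CechForms V 𝕜 𝒱 Z a.1.1 a.1.2)
    ⟨(p, q), h⟩ σ, Pi.single_eq_same _ _, fun a ha ↦ Pi.single_eq_of_ne ha _⟩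

/-! ### Components of the total differential -/

theorem totalD_apply_succ_succ (hZ : IsEmptyOrClosureOfOpen Z) {r p q : ℕ}
    (x : CechTotal V 𝕜 𝒱 Z r) (h : p + 1 + (q + 1) = r + 1) :
    totalD 𝒱 hZ r x ⟨(p + 1, q + 1), h⟩ = cechδ 𝒱 Z (p + 1) q (x ⟨(p + 1, q), by omega⟩) +
      (-1 : 𝕜) ^ (q + 1) • cechd 𝒱 hZ p (q + 1) (x ⟨(p, q + 1), by omega⟩) := rfl

theorem totalD_apply_zero_succ (hZ : IsEmptyOrClosureOfOpen Z) {r q : ℕ}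
    (x : CechTotal V 𝕜 𝒱 Z r) (h : 0 + (q + 1) = r + 1) :
    totalD 𝒱 hZ r x ⟨(0, q + 1), h⟩ = cechδ 𝒱 Z 0 q (x ⟨(0, q), by omega⟩) := by
  change cechδ 𝒱 Z 0 q (x ⟨(0, q), _⟩) + (-1 : 𝕜) ^ (q + 1) • 0 = _
  rw [smul_zero, add_zero]

theorem totalD_apply_succ_zero (hZ : IsEmptyOrClosureOfOpen Z) {r p : ℕ}
    (x : CechTotal V 𝕜 𝒱 Z r) (h : p + 1 + 0 = r + 1) :
    totalD 𝒱 hZ r x ⟨(p + 1, 0), h⟩ = cechd 𝒱 hZ p 0 (x ⟨(p, 0), by omega⟩) := by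
  change 0 + (-1 : 𝕜) ^ 0 • cechd 𝒱 hZ p 0 (x ⟨(p, 0), _⟩) = _
  rw [pow_zero, one_smul]
  exact zero_add _

/-- The total differential at a component next to which the cochain vanishes. -/
theorem totalD_apply_of_eq_zero (hZ : IsEmptyOrClosureOfOpen Z) {r p q : ℕ}
    (x : CechTotal V 𝕜 𝒱 Z r) (h : p + q = r)
    (hx : ∀ p' (h' : p' + (q + 1) = r), x ⟨(p', q + 1), h'⟩ = 0) :
    totalD 𝒱 hZ r x ⟨(p, q + 1), by change p + (q + 1) = r + 1; omega⟩ =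
      cechδ 𝒱 Z p q (x ⟨(p, q), h⟩) := by
  cases p with
  | zero => exact totalD_apply_zero_succ hZ x _
  | succ p =>
    rw [totalD_apply_succ_succ, hx, map_zero]
    exact add_eq_left.2 (smul_zero _)

theorem neg_one_pow_smul_cancel {M : Type*} [AddCommGroup M] [Module 𝕜 M] (b : M) (n : ℕ) :
    (-1 : 𝕜) ^ n • b + (-1 : 𝕜) ^ (n + 1) • b = 0 := by
  rw [← add_smul, pow_succ, mul_neg_one, add_neg_cancel, zero_smul]

/-- The two mixed terms `δd` and `dδ` agree and carry consecutive powers of `-1`. -/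
theorem cechδ_add_cechd_cancel (hZ : IsEmptyOrClosureOfOpen Z) {p q : ℕ}
    (σ : CechForms V 𝕜 𝒱 Z (p + 1) q) (τ : CechForms V 𝕜 𝒱 Z p (q + 1)) (n : ℕ)
    (hσ : cechδ 𝒱 Z (p + 1) (q + 1) (cechδ 𝒱 Z (p + 1) q σ) = 0) :
    cechδ 𝒱 Z (p + 1) (q + 1) (cechδ 𝒱 Z (p + 1) q σ + (-1 : 𝕜) ^ n • cechd 𝒱 hZ p (q + 1) τ) +
      (-1 : 𝕜) ^ (n + 1) • cechd 𝒱 hZ p (q + 1 + 1) (cechδ 𝒱 Z p (q + 1) τ) = 0 := by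
  rw [LinearMap.map_add, hσ, LinearMap.map_smul, cechδ_cechd]
  exact (congrArg (· + _) (zero_add _)).trans (neg_one_pow_smul_cancel _ n)

theorem cechd_totalD_apply_succ (hZ : IsEmptyOrClosureOfOpen Z) {r p q : ℕ}
    (x : CechTotal V 𝕜 𝒱 Z r) (h : p + (q + 1) = r + 1) (h' : p + q = r) :
    cechd 𝒱 hZ p (q + 1) (totalD 𝒱 hZ r x ⟨(p, q + 1), h⟩) =
      cechd 𝒱 hZ p (q + 1) (cechδ 𝒱 Z p q (x ⟨(p, q), h'⟩)) := by
  cases p with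
  | zero => rw [totalD_apply_zero_succ]
  | succ p => rw [totalD_apply_succ_succ, cechd_add_smul_cechd]

/-- The identity `δδ = 0` is assumed only on the components of `x`. In the zigzag the single nonzero
component is a `δ`-primitive of a known `δ`-cocycle, so the assumption is immediate there. -/
theorem totalD_totalD (hZ : IsEmptyOrClosureOfOpen Z) {r : ℕ} (x : CechTotal V 𝕜 𝒱 Z r)
    (hx : ∀ p q (h : p + q = r), cechδ 𝒱 Z p (q + 1) (cechδ 𝒱 Z p q (x ⟨(p, q), h⟩)) = 0) :
    totalD 𝒱 hZ (r + 1) (totalD 𝒱 hZ r x) = 0 := by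
  funext ⟨⟨p, q⟩, h⟩
  change p + q = r + 1 + 1 at h
  change _ = (0 : CechForms V 𝕜 𝒱 Z p q)
  match p, q, h with
  | 0, 0, h | 0, 1, h | 1, 0, h => omega
  | 0, q + 1 + 1, h =>
    rw [totalD_apply_zero_succ, totalD_apply_zero_succ]
    exact hx 0 q (by omega)
  | p + 1 + 1, 0, h =>
    rw [totalD_apply_succ_zero, totalD_apply_succ_zero, cechd_cechd]
  | p + 1, 0 + 1, h =>
    have h1 : p + 0 = r := by omega
    rw [totalD_apply_succ_succ, cechd_totalD_apply_succ hZ x _ h1, totalD_apply_succ_zero,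
      cechδ_cechd hZ (x ⟨(p, 0), h1⟩), pow_succ, pow_zero, one_mul]
    exact (congrArg _ (neg_one_smul 𝕜 _)).trans (add_neg_cancel _)
  | p + 1, q + 1 + 1, h =>
    have h1 : p + (q + 1) = r := by omega
    have h2 : p + 1 + q = r := by omega
    rw [totalD_apply_succ_succ, cechd_totalD_apply_succ hZ x _ h1, totalD_apply_succ_succ]
    exact cechδ_add_cechd_cancel hZ (x ⟨(p + 1, q), h2⟩) (x ⟨(p, q + 1), h1⟩) (q + 1)
      (hx (p + 1) q h2)

/-! ### The zigzag down to Čech degree zero -/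

theorem totalRes_apply_succ {r p q : ℕ} (θ : vanishingForms V 𝕜 univ Z r) (h : p + (q + 1) = r) :
    totalRes 𝒱 Z r θ ⟨(p, q + 1), h⟩ = 0 := rfl

theorem totalRes_injective (h𝒱 : (⋃ j, (𝒱 j : Set X)) = univ) (r : ℕ) :
    Function.Injective (totalRes (V := V) (𝕜 := 𝕜) 𝒱 Z r) := fun _ _ h ↦
  cechRes_injective h𝒱 r (congrFun h ⟨(r, 0), rfl⟩)

/-- A cochain whose differential is concentrated in Čech degree zero is cohomologous to a global
form. -/
theorem exists_sub_totalRes_mem (h𝒱 : (⋃ j, (𝒱 j : Set X)) = univ)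
    (hZ : IsEmptyOrClosureOfOpen Z) {r : ℕ} (n : ℕ) (x : CechTotal V 𝕜 𝒱 Z r)
    (hx : ∀ p q (h : p + (q + 1) = r + 1), totalD 𝒱 hZ r x ⟨(p, q + 1), h⟩ = 0)
    (hn : ∀ p q (h : p + q = r), n < q → x ⟨(p, q), h⟩ = 0) :
    ∃ θ : vanishingForms V 𝕜 univ Z r, totalD 𝒱 hZ r x = totalD 𝒱 hZ r (totalRes 𝒱 Z r θ) ∧
      x - totalRes 𝒱 Z r θ ∈
        coboundaries (M := fun s ↦ CechTotal V 𝕜 𝒱 Z s) (fun s ↦ totalD 𝒱 hZ s) r := by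
  -- Here `n` bounds the Čech degrees in which `x` lives. Each step subtracts a coboundary that
  -- cancels the top component; at `n = 0` the remaining `δ`-closed component is a global form.
  induction n generalizing x with
  | zero =>
    have hδ : cechδ 𝒱 Z r 0 (x ⟨(r, 0), rfl⟩) = 0 := by
      rw [← totalD_apply_of_eq_zero hZ x rfl fun p h ↦ hn _ _ _ zero_lt_one]
      exact hx _ _ _
    obtain ⟨θ, hθ⟩ := exists_cechRes_eq h𝒱 _ hδ
    have hxθ : x = totalRes 𝒱 Z r θ := by
      funext ⟨⟨p, q⟩, h⟩
      change p + q = r at h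
      cases q with
      | zero =>
        obtain rfl : p = r := h
        exact hθ.symm
      | succ q => exact hn _ _ h q.succ_pos
    refine ⟨θ, by rw [← hxθ], ?_⟩
    rw [← hxθ, sub_self]
    exact Submodule.zero_mem _
  | succ n ih =>
    -- In this case no component of total degree `r` has Čech degree `n + 1`, and the smaller bound
    -- already holds.
    by_cases hr : r ≤ n
    · exact ih x hx fun p q h hq ↦ by omega
    obtain ⟨p, rfl⟩ : ∃ p, r = p + n + 1 := ⟨r - (n + 1), by omega⟩
    have hp : p + (n + 1) = p + n + 1 := rfl
    have hδ : cechδ 𝒱 Z p (n + 1) (x ⟨(p, n + 1), hp⟩) = 0 := by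
      rw [← totalD_apply_of_eq_zero hZ x hp fun p h ↦ hn _ _ _ (Nat.lt_succ_self _)]
      exact hx _ _ _
    -- The top component is `δ`-closed because nothing of higher Čech degree contributes to `Dx`
    -- next to it. Its primitive `τ`, placed in bidegree `(p, n)`, is the cochain `z` whose
    -- differential is subtracted.
    obtain ⟨τ, hτ⟩ := exists_cechδ_eq h𝒱 _ hδ
    obtain ⟨z, hzτ, hz0⟩ := exists_cechTotal_single (rfl : p + n = p + n) τ
    have hz : ∀ p' q' (h : p' + q' = p + n), q' ≠ n → z ⟨(p', q'), h⟩ = 0 := fun p' q' h hq ↦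
      hz0 _ fun e ↦ hq (congrArg (fun a ↦ a.1.2) e)
    have hzz : totalD 𝒱 hZ (p + n + 1) (totalD 𝒱 hZ (p + n) z) = 0 := by
      refine totalD_totalD hZ z fun p' q' h ↦ ?_
      by_cases hq : q' = n
      · subst hq
        obtain rfl : p' = p := by omega
        rw [hzτ, hτ, hδ]
      · rw [hz p' q' h hq, map_zero, map_zero]
    have hD : totalD 𝒱 hZ (p + n + 1) (x - totalD 𝒱 hZ (p + n) z) =
        totalD 𝒱 hZ (p + n + 1) x := by
      rw [map_sub, hzz, sub_zero]
    -- In Čech degree `n + 1` the difference is `δτ - δτ = 0`; in higher Čech degrees both terms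
    -- vanish.
    obtain ⟨θ, hθ, z', hz'⟩ := ih (x - totalD 𝒱 hZ (p + n) z)
      (fun p' q' h ↦ by rw [hD, hx]) fun p' q' h hq ↦ by
        obtain ⟨q', rfl⟩ : ∃ k, q' = k + 1 := ⟨q' - 1, by omega⟩
        have h1 := totalD_apply_of_eq_zero (p := p') (q := q') hZ z (by omega)
          fun p'' h'' ↦ hz _ _ _ (by omega)
        rw [Pi.sub_apply, h1]
        by_cases hqn : q' = n
        · subst hqn
          obtain rfl : p' = p := by omega
          rw [hzτ, hτ, sub_self]
        · rw [hz _ _ _ hqn, map_zero, hn _ _ _ (by omega), sub_zero]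
    refine ⟨θ, hD.symm.trans hθ, z' + z, ?_⟩
    rw [map_add]
    change totalD 𝒱 hZ (p + n) z' = _ at hz'
    rw [hz']
    abel

/-- If `Pθ = Dy`, then `Dy` has no component of positive Čech degree, so `Dy = D(Pθ') = P(dθ')` for
a global form `θ'`. Injectivity of `P` on forms gives `θ = dθ'`. -/
theorem restrictionCohomology_injective (h𝒱 : (⋃ j, (𝒱 j : Set X)) = univ)
    (hZ : IsEmptyOrClosureOfOpen Z) (r : ℕ) :
    Function.Injective (restrictionCohomology V 𝕜 𝒱 hZ r) := by
  refine Cohomology.map_injective _ r fun θ hθ h ↦ ?_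
  match r, θ, h with
  | 0, θ, h => exact totalRes_injective h𝒱 0 (Eq.trans h (map_zero _).symm)
  | r + 1, θ, ⟨y, hy⟩ =>
    change totalD 𝒱 hZ r y = _ at hy
    obtain ⟨θ', hθ', -⟩ := exists_sub_totalRes_mem h𝒱 hZ r y
      (fun p q h ↦ by rw [hy, totalRes_apply_succ]) fun p q h hq ↦ by omega
    refine ⟨θ', totalRes_injective h𝒱 (r + 1) ?_⟩
    rw [← hy, hθ', totalRes_d]

/-- A total cocycle `y` is cohomologous to some `Pθ` with `P(dθ) = Dy = 0`, and `θ` is closed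
because `P` is injective on forms. The starting bound `r` on the Čech degree holds trivially in
total degree `r`. -/
theorem restrictionCohomology_surjective (h𝒱 : (⋃ j, (𝒱 j : Set X)) = univ)
    (hZ : IsEmptyOrClosureOfOpen Z) (r : ℕ) :
    Function.Surjective (restrictionCohomology V 𝕜 𝒱 hZ r) := by
  refine Cohomology.map_surjective _ r fun y hy ↦ ?_
  obtain ⟨θ, hθ, hyθ⟩ := exists_sub_totalRes_mem h𝒱 hZ r y
    (fun p q h ↦ by rw [hy]; rfl) fun p q h hq ↦ by omega
  refine ⟨θ, totalRes_injective h𝒱 (r + 1) ?_, ?_⟩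
  · rw [totalRes_d, ← hθ, hy, map_zero]
  · rw [← neg_sub]
    exact Submodule.neg_mem _ hyθ

end Cech

end Comparison

end ExtendableForms

end

/-! ### The isomorphism -/

theorem mainTheorem5 {L X J : Type*} [TopologicalSpace X]
    (V : ExtendableForms.AnalyticVariety L X) (𝕜 : Type*) [RCLike 𝕜]
    (Z : Set X) (hZ : ExtendableForms.IsEmptyOrClosureOfOpen Z)
    (𝒱 : J → TopologicalSpace.Opens X) (h𝒱 : (⋃ j, (𝒱 j : Set X)) = Set.univ)
    (h𝒱Z : ExtendableForms.IsAdapted 𝒱 Z) (r : ℕ) :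
    Function.Bijective (ExtendableForms.toPairCohomology V 𝕜 hZ r) ∧
    ∃ P : ExtendableForms.PairCohomology V 𝕜 hZ r ≃ₗ[𝕜]
        ExtendableForms.CechCohomology V 𝕜 𝒱 hZ r,
      ∀ c : ExtendableForms.VanishingCohomology V 𝕜 hZ r,
        P (ExtendableForms.toPairCohomology V 𝕜 hZ r c) =
          ExtendableForms.restrictionCohomology V 𝕜 𝒱 hZ r c := by
  have hA : Function.Bijective (ExtendableForms.toPairCohomology V 𝕜 hZ r) :=
    ⟨ExtendableForms.toPairCohomology_injective hZ r,
      ExtendableForms.toPairCohomology_surjective hZ r⟩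
  have hP : Function.Bijective (ExtendableForms.restrictionCohomology V 𝕜 𝒱 hZ r) :=
    ⟨ExtendableForms.restrictionCohomology_injective h𝒱 hZ r,
      ExtendableForms.restrictionCohomology_surjective h𝒱 hZ r⟩
  refine ⟨hA, (LinearEquiv.ofBijective _ hA).symm.trans (LinearEquiv.ofBijective _ hP),
    fun c ↦ ?_⟩
  rw [LinearEquiv.trans_apply, LinearEquiv.ofBijective_apply]
  exact congrArg _ ((LinearEquiv.ofBijective _ hA).symm_apply_apply c)
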